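/- **Setting.** For each $I\ge 1$ consider a matched study with $I$ matched sets; all objects below may depend on $I$. Set $i$ has $n_i\ge 2$ units with fixed potential outcomes $Y_{ij}(1),Y_{ij}(0)$, and exactly one of its units is treated. Let $Z_{ij}\in\{0,1\}$ be the treatment indicators (conditional on one treated unit in each set). They are independent across sets, with $p^\star_{ij}=\mathbb P(Z_{ij}=1)$. The true hidden bias of set $i$ is $\Gamma_i^\star=\max_j p^\star_{ij}/\min_j p^\star_{ij}\in[1,\infty]$ ($=\infty$ if the minimum is $0$), and $\Gamma^\star_{(1)}\le\dots\le\Gamma^\star_{(I)}$ are the sorted values. Assume Fisher's null $Y_{ij}(0)=Y_{ij}(1)$ for all $i,j$. Let $T=\sum_i T_i$, $T_i=\sum_j Z_{ij}q_{ij}$, where the $q_{ij}$ are arbitrary real functions of the vector $\mathbf Y(0)$ (which equals the observed outcome vector under the null). Let $R_i=\max_jq_{ij}-\min_jq_{ij}$, $\mu_i=\mathbb E T_i$, $v_i^2=\mathrm{Var}(T_i)$. **Sensitivity models.** For $\Gamma=(\Gamma_1,\dots,\Gamma_I)\in[1,\infty]^I$, the sensitivity models with biases at most $\Gamma$ are the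 laws of $\mathbf Z$ that are independent across sets and for which in each set $i$ with $\Gamma_i<\infty$ unit $j$ is treated with probability $\Gamma_i^{u_{ij}}/\sum_l\Gamma_i^{u_{il}}$ for some $u_{i1},\dots,u_{in_i}\in[0,1]$, while in each set with $\Gamma_i=\infty$ the law of the treated unit is arbitrary. Let $\mu(\Gamma)$ be the maximum of $\mathbb E\,T$ over these models and $\sigma^2(\Gamma)$ the maximum of $\mathrm{Var}(T)$ over those models that maximize $\mathbb E\,T$. Let $\mu_i(\Gamma_i)$ and $v_i^2(\Gamma_i)$ be the same two maxima for the single statistic $T_i$. For $\Gamma_0\in[1,\infty)$ and $\mathcal I\subset\{1,\dots,I\}$, let $\Gamma_0\mathbf 1_{\mathcal I}+\infty\mathbf 1_{\mathcal I^c}$ be the vector with entries $\Gamma_0$ on $\mathcal I$ and $\infty$ off $\mathcal I$, and write $\mu(\Gamma_0;\mathcal I)$, $\sigma^2(\Gamma_0;\mathcal I)$ for the values of $\mu(\cdot)$, $\sigma^2(\cdot)$ at it. For $1\le k\le I$ put $$\mu(\Gamma_0;k)=\max_{|\mathcal I|=k}\mu(\Gamma_0;\mathcal I),\qquad \sigma^2(\Gamma_0;k)=\max_{|\mathcal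 I|=k,\ \mu(\Gamma_0;\mathcal I)=\mu(\Gamma_0;k)}\sigma^2(\Gamma_0;\mathcal I).$$ Rank the sets by $\mu_i(\infty)-\mu_i(\Gamma_0)$, ties being ranked so that a smaller $v_i^2(\Gamma_0)$ gets a larger rank (remaining ties are broken arbitrarily), and let $\mathcal I_{\Gamma_0;k}$ be the $k$ sets of smallest rank. Let $\mathcal I^\star_k$ be $k$ sets with the smallest $\Gamma^\star_i$ (ties broken arbitrarily). **Regularity conditions.** Put $S=\sum_{i=1}^I R_i^2/(n_i\Gamma_i^\star)^3$ (terms with $\Gamma^\star_i=\infty$ are $0$). As $I\to\infty$: 1. $S>0$ for all large $I$, and $\max_i R_i^2/S\to0$. 2. With $\Gamma=\Gamma_0\mathbf 1_{\mathcal I^\star_k}+\infty\mathbf 1_{(\mathcal I^\star_k)^c}$ and $\mathcal A=\{i: v_i^2>v_i^2(\Gamma_i)\}$, let $\Delta_\mu$ and $\Delta_{v^2}$ be the averages over $i\in\mathcal A$ of $\mu_i(\Gamma_i)-\mu_i$ and of $v_i^2-v_i^2(\Gamma_i)$; then $(\Delta_\mu/\Delta_{v^2})\sqrt S\to\infty$,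 where the expression is read as $\infty$ if $\mathcal A=\emptyset$. 3. With $\mathcal B=\{(i,j): i\in\mathcal I_{\Gamma_0;k}\setminus\mathcal I^\star_k,\ j\in\mathcal I^\star_k\setminus\mathcal I_{\Gamma_0;k},\ v_i^2(\Gamma_0)<v_j^2(\Gamma_0)\}$, let $\Delta'_\mu$ and $\Delta'_{v^2}$ be the averages over $(i,j)\in\mathcal B$ of $\{\mu_j(\infty)-\mu_j(\Gamma_0)\}-\{\mu_i(\infty)-\mu_i(\Gamma_0)\}$ and of $v_j^2(\Gamma_0)-v_i^2(\Gamma_0)$; then $(\Delta'_\mu/\Delta'_{v^2})\sqrt{\sum_{i\in\mathcal I^\star_k}R_i^2/(n_i\Gamma_0)^3}\to\infty$, where the expression is read as $\infty$ if $\mathcal B=\emptyset$. **Theorem.** Let $1\le k\le I$ and $\Gamma_0\in[1,\infty)$, both possibly depending on $I$, assume $\Gamma^\star_{(k)}\le\Gamma_0$ for every $I$, Fisher's null, and conditions 1–3. Then: (a) for every $I$ the set $\mathcal I_{\Gamma_0;k}$ attains both maxima, $\mu(\Gamma_0;\mathcal I_{\Gamma_0;k})=\mu(\Gamma_0;k)$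 and $\sigma^2(\Gamma_0;\mathcal I_{\Gamma_0;k})=\sigma^2(\Gamma_0;k)$, and $$\mu(\Gamma_0;k)=\sum_{i\in\mathcal I_{\Gamma_0;k}}\mu_i(\Gamma_0)+\sum_{i\notin\mathcal I_{\Gamma_0;k}}\max_j q_{ij},\qquad \sigma^2(\Gamma_0;k)=\sum_{i\in\mathcal I_{\Gamma_0;k}}v_i^2(\Gamma_0);$$ (b) for every $c\ge0$, $$\limsup_{I\to\infty}\mathbb P\{T\ge\mu(\Gamma_0;k)+c\,\sigma(\Gamma_0;k)\}\le1-\Phi(c),$$ where $\Phi$ is the standard normal distribution function; and, whenever $\sigma(\Gamma_0;k)>0$, $1-\Phi(c)=\mathbb P\{\tilde T\ge\mu(\Gamma_0;k)+c\,\sigma(\Gamma_0;k)\}$ for $\tilde T\sim\mathcal N(\mu(\Gamma_0;k),\sigma^2(\Gamma_0;k))$. -/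

import Mathlib

open MeasureTheory ProbabilityTheory Filter Topology
open scoped ENNReal NNReal

noncomputable section

/-- A matched observational study with `I` matched sets.  Set `i` has `n i ≥ 2` units, exactly one
of which is treated.  Potential outcomes are fixed; the only randomness is in the assignment.
An assignment with exactly one treated unit in each set is recorded by the label `Z ω i` of the
treated unit of set `i`, and `P` is the conditional distribution given that there is exactly one
treated unit in each set.  Assignments are independent across sets. -/
structure MatchedStudy (I : ℕ) (Ω : Type*) [MeasurableSpace Ω] where
  /-- sizes of the matched sets -/
  n : Fin I → ℕ
  two_le_n : ∀ i, 2 ≤ n i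
  /-- treatment potential outcomes -/
  Y1 : (i : Fin I) → Fin (n i) → ℝ
  /-- control potential outcomes -/
  Y0 : (i : Fin I) → Fin (n i) → ℝ
  /-- the scores of the test statistic, arbitrary functions of an outcome vector -/
  q : ((i : Fin I) → Fin (n i) → ℝ) → (i : Fin I) → Fin (n i) → ℝ
  /-- the randomization distribution -/
  P : Measure Ω
  isProb : IsProbabilityMeasure P
  /-- the treated unit of each set -/
  Z : Ω → (i : Fin I) → Fin (n i)
  measurable_Z : Measurable Z
  indep : iIndepFun (fun i ω => Z ω i) P

/-- The probabilities that a sensitivity model with finite bias bound `Γ` and hidden confounding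
`u` gives to the units of one matched set: `exp (γ u j) / ∑ l, exp (γ u l)`, `γ = log Γ`. -/
def sensProb {m : ℕ} (Γ : ℝ) (u : Fin m → ℝ) : Fin m → ℝ :=
  fun j => Real.exp (Real.log Γ * u j) / ∑ l, Real.exp (Real.log Γ * u l)

/-- The laws of the treated unit of one matched set of size `m` under a sensitivity model with bias
at most `Γ ∈ [1, ∞]`: those given by some `u ∈ [0,1]^m` if `Γ < ∞`, and all laws if `Γ = ∞`. -/
def sensLaws (m : ℕ) (Γ : ℝ≥0∞) : Set (Fin m → ℝ) :=
  {p | (Γ = ⊤ ∧ p ∈ stdSimplex ℝ (Fin m)) ∨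
    (Γ ≠ ⊤ ∧ ∃ u : Fin m → ℝ, (∀ j, u j ∈ Set.Icc (0 : ℝ) 1) ∧ p = sensProb Γ.toReal u)}

/-- The `k`-th smallest of the values of `f`, for `1 ≤ k ≤ I`. -/
def orderStat {I : ℕ} (f : Fin I → ℝ≥0∞) (k : ℕ) : ℝ≥0∞ :=
  if h : k - 1 < I then f (Tuple.sort f ⟨k - 1, h⟩) else ⊤

/-- `J` consists of `k` indices with the smallest values of `f` (ties broken in any way). -/
def IsKSmallest {I : ℕ} (f : Fin I → ℝ≥0∞) (k : ℕ) (J : Finset (Fin I)) : Prop :=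
  J.card = k ∧ ∀ i ∈ J, ∀ j ∉ J, f i ≤ f j

namespace MatchedStudy

variable {I : ℕ} {Ω : Type*} [MeasurableSpace Ω] (S : MatchedStudy I Ω)

/-- Assignments with exactly one treated unit in each set. -/
abbrev Assign : Type := (i : Fin I) → Fin (S.n i)

/-- The treatment indicator of unit `j` in set `i`. -/
def ind (z : S.Assign) (i : Fin I) (j : Fin (S.n i)) : ℝ := if z i = j then 1 else 0

/-- The observed outcomes under the assignment `z`. -/
def obs (z : S.Assign) : (i : Fin I) → Fin (S.n i) → ℝ :=
  fun i j => S.ind z i j * S.Y1 i j + (1 - S.ind z i j) * S.Y0 i j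

/-- Fisher's null hypothesis of no causal effect. -/
def FisherNull : Prop := ∀ i j, S.Y0 i j = S.Y1 i j

/-- The contribution of set `i` to the test statistic. -/
def tset (i : Fin I) (z : S.Assign) (y : (i : Fin I) → Fin (S.n i) → ℝ) : ℝ :=
  ∑ j, S.ind z i j * S.q y i j

/-- The test statistic as a function `t(z, y)` of assignment and outcomes. -/
def t (z : S.Assign) (y : (i : Fin I) → Fin (S.n i) → ℝ) : ℝ := ∑ i, S.tset i z y

/-- The statistic of set `i` computed from the observed data. -/
def Ti (i : Fin I) (ω : Ω) : ℝ := S.tset i (S.Z ω) (S.obs (S.Z ω))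

/-- The test statistic computed from the observed data. -/
def T (ω : Ω) : ℝ := S.t (S.Z ω) (S.obs (S.Z ω))

/-! ### The true assignment mechanism -/

/-- The true probability that unit `j` is the treated unit of set `i`. -/
def pStar (i : Fin I) (j : Fin (S.n i)) : ℝ≥0∞ := S.P {ω | S.Z ω i = j}

/-- The true hidden bias of set `i`: the ratio of the largest to the smallest treatment
probability, which is `∞` if the smallest one is zero. -/
def GammaStar (i : Fin I) : ℝ≥0∞ := (⨆ j, S.pStar i j) / (⨅ j, S.pStar i j)

/-- The true mean of the statistic of set `i`. -/
def mean (i : Fin I) : ℝ := ∫ ω, S.Ti i ω ∂S.P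

/-- The true variance of the statistic of set `i`. -/
def var (i : Fin I) : ℝ := variance (S.Ti i) S.P

/-! ### Maximized means and variances, set by set -/

/-- The score of unit `j` in set `i` at the control potential outcomes. -/
def q0 (i : Fin I) (j : Fin (S.n i)) : ℝ := S.q S.Y0 i j

/-- The range of the scores of set `i`. -/
def R (i : Fin I) : ℝ := (⨆ j, S.q0 i j) - ⨅ j, S.q0 i j

/-- The mean of the statistic of set `i` when `p` is the law of its treated unit. -/
def setMean (i : Fin I) (p : Fin (S.n i) → ℝ) : ℝ := ∑ j, p j * S.q0 i j

/-- The variance of the statistic of set `i` when `p` is the law of its treated unit. -/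
def setVar (i : Fin I) (p : Fin (S.n i) → ℝ) : ℝ := ∑ j, p j * (S.q0 i j - S.setMean i p) ^ 2

/-- `μ_i(Γ)`: the maximum mean for set `i` under bias at most `Γ`. -/
def muSet (i : Fin I) (Γ : ℝ≥0∞) : ℝ := sSup (S.setMean i '' sensLaws (S.n i) Γ)

/-- `v_i²(Γ)`: the maximum variance for set `i` among the laws that maximize the mean. -/
def varSet (i : Fin I) (Γ : ℝ≥0∞) : ℝ :=
  sSup (S.setVar i '' {p | p ∈ sensLaws (S.n i) Γ ∧ S.setMean i p = S.muSet i Γ})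

/-! ### Maximized mean and variance of the whole statistic -/

/-- Expectation of `f (Z)` when the treated units are independent with laws `p i`. -/
def expect (p : (i : Fin I) → Fin (S.n i) → ℝ) (f : S.Assign → ℝ) : ℝ :=
  ∑ z : S.Assign, (∏ i, p i (z i)) * f z

/-- The mean of `t(Z, Y(0))` when the treated units are independent with laws `p i`. -/
def modelMean (p : (i : Fin I) → Fin (S.n i) → ℝ) : ℝ := S.expect p fun z => S.t z S.Y0

/-- The variance of `t(Z, Y(0))` when the treated units are independent with laws `p i`. -/
def modelVar (p : (i : Fin I) → Fin (S.n i) → ℝ) : ℝ :=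
  S.expect p fun z => (S.t z S.Y0 - S.modelMean p) ^ 2

/-- The sensitivity models with hidden biases at most `Γ ∈ [1, ∞]^I`. -/
def models (Γ : Fin I → ℝ≥0∞) : Set ((i : Fin I) → Fin (S.n i) → ℝ) :=
  {p | ∀ i, p i ∈ sensLaws (S.n i) (Γ i)}

/-- `μ(Γ)`: the maximum mean over the sensitivity models with biases at most `Γ`. -/
def muVec (Γ : Fin I → ℝ≥0∞) : ℝ := sSup (S.modelMean '' S.models Γ)

/-- `σ²(Γ)`: the maximum variance among the models that maximize the mean. -/
def varVec (Γ : Fin I → ℝ≥0∞) : ℝ :=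
  sSup (S.modelVar '' {p | p ∈ S.models Γ ∧ S.modelMean p = S.muVec Γ})

/-- The bias bounds `Γ₀` on `J` and `∞` off `J`. -/
def bound (Γ₀ : ℝ) (J : Finset (Fin I)) : Fin I → ℝ≥0∞ :=
  fun i => if i ∈ J then ENNReal.ofReal Γ₀ else ⊤

/-- `μ(Γ₀; k)`: the maximum of `μ(Γ₀; J)` over the index sets `J` of cardinality `k`. -/
def muK (Γ₀ : ℝ) (k : ℕ) : ℝ :=
  sSup ((fun J => S.muVec (bound Γ₀ J)) '' {J : Finset (Fin I) | J.card = k})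

/-- `σ²(Γ₀; k)`: the maximum of `σ²(Γ₀; J)` over the `J` of cardinality `k` that maximize the
mean. -/
def varK (Γ₀ : ℝ) (k : ℕ) : ℝ :=
  sSup ((fun J => S.varVec (bound Γ₀ J)) ''
    {J : Finset (Fin I) | J.card = k ∧ S.muVec (bound Γ₀ J) = S.muK Γ₀ k})

/-- `σ(Γ₀; k)`. -/
def sdK (Γ₀ : ℝ) (k : ℕ) : ℝ := √(S.varK Γ₀ k)

/-- `μ_i(∞) - μ_i(Γ₀)`. -/
def gap (Γ₀ : ℝ) (i : Fin I) : ℝ := S.muSet i ⊤ - S.muSet i (ENNReal.ofReal Γ₀)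

/-- `v_i²(Γ₀)`. -/
def v2 (Γ₀ : ℝ) (i : Fin I) : ℝ := S.varSet i (ENNReal.ofReal Γ₀)

/-- `J` consists of the `k` sets of smallest rank, when the sets are ranked by
`μ_i(∞) - μ_i(Γ₀)`, ties are ranked so that a smaller `v_i²(Γ₀)` gets a larger rank, and the
remaining ties are broken in any way. -/
def IsRankSet (Γ₀ : ℝ) (k : ℕ) (J : Finset (Fin I)) : Prop :=
  J.card = k ∧ ∀ i ∈ J, ∀ j ∉ J,
    S.gap Γ₀ i < S.gap Γ₀ j ∨ (S.gap Γ₀ i = S.gap Γ₀ j ∧ S.v2 Γ₀ j ≤ S.v2 Γ₀ i)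

/-! ### Quantities in the regularity conditions -/

/-- `∑_i R_i² / (n_i Γ_i⋆)³`, where a set with infinite bias contributes zero. -/
def info : ℝ :=
  ∑ i, (ENNReal.ofReal (S.R i ^ 2) / ((S.n i : ℝ≥0∞) * S.GammaStar i) ^ 3).toReal

/-- `∑_{i ∈ J} R_i² / (n_i Γ₀)³`. -/
def infoOn (Γ₀ : ℝ) (J : Finset (Fin I)) : ℝ := ∑ i ∈ J, S.R i ^ 2 / ((S.n i : ℝ) * Γ₀) ^ 3

/-- The sets whose true variance exceeds the maximized variance. -/
def setA (Γ : Fin I → ℝ≥0∞) : Finset (Fin I) := {i | S.varSet i (Γ i) < S.var i}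

/-- The average of `μ_i(Γ_i) - μ_i` over `setA`. -/
def deltaMu (Γ : Fin I → ℝ≥0∞) : ℝ :=
  ((S.setA Γ).card : ℝ)⁻¹ * ∑ i ∈ S.setA Γ, (S.muSet i (Γ i) - S.mean i)

/-- The average of `v_i² - v_i²(Γ_i)` over `setA`. -/
def deltaVar (Γ : Fin I → ℝ≥0∞) : ℝ :=
  ((S.setA Γ).card : ℝ)⁻¹ * ∑ i ∈ S.setA Γ, (S.var i - S.varSet i (Γ i))

/-- `Δ_μ(Γ) / Δ_{v²}(Γ) · √info`, infinite when `setA` is empty. -/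
def ratioA (Γ : Fin I → ℝ≥0∞) : ℝ≥0∞ :=
  if S.setA Γ = ∅ then ⊤ else ENNReal.ofReal (S.deltaMu Γ / S.deltaVar Γ * √S.info)

/-- The pairs `(i, j)` with `i ∈ J \ K`, `j ∈ K \ J` and `v_i²(Γ₀) < v_j²(Γ₀)`. -/
def setB (Γ₀ : ℝ) (J K : Finset (Fin I)) : Finset (Fin I × Fin I) :=
  {x ∈ (J \ K) ×ˢ (K \ J) | S.v2 Γ₀ x.1 < S.v2 Γ₀ x.2}

/-- The average of `(μ_j(∞) - μ_j(Γ₀)) - (μ_i(∞) - μ_i(Γ₀))` over `setB`. -/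
def deltaMuB (Γ₀ : ℝ) (J K : Finset (Fin I)) : ℝ :=
  ((S.setB Γ₀ J K).card : ℝ)⁻¹ * ∑ x ∈ S.setB Γ₀ J K, (S.gap Γ₀ x.2 - S.gap Γ₀ x.1)

/-- The average of `v_j²(Γ₀) - v_i²(Γ₀)` over `setB`. -/
def deltaVarB (Γ₀ : ℝ) (J K : Finset (Fin I)) : ℝ :=
  ((S.setB Γ₀ J K).card : ℝ)⁻¹ * ∑ x ∈ S.setB Γ₀ J K, (S.v2 Γ₀ x.2 - S.v2 Γ₀ x.1)

/-- `Δ_μ(Γ₀; k) / Δ_{v²}(Γ₀; k) · √(∑_{i ∈ K} R_i² / (n_i Γ₀)³)`, infinite when `setB` is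
empty. -/
def ratioB (Γ₀ : ℝ) (J K : Finset (Fin I)) : ℝ≥0∞ :=
  if S.setB Γ₀ J K = ∅ then ⊤
  else ENNReal.ofReal (S.deltaMuB Γ₀ J K / S.deltaVarB Γ₀ J K * √(S.infoOn Γ₀ K))

end MatchedStudy

end

/-! ### A central limit theorem for triangular arrays of bounded variables -/

/-! Under Fisher's null the scores are fixed numbers, so `T` is a sum of independent bounded
variables. The regularity conditions make each of them negligible against the true standard
deviation, and a Lindeberg argument (`tendsto_measureReal_le_T`) gives `1 - Φ(c)` as the limiting
probability that `T` exceeds its true threshold, mean plus `c` standard deviations. It remains to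
show that the worst-case threshold eventually lies above the true one.

This takes two comparisons. From the truth to the bounds `Γ₀` on `K`, `∞` off `K`: the true law
belongs to that model, so no mean decreases, although some variances may
(`sum_mean_add_mul_sqrt_le`). From `K` to `J`: the mean again does not decrease, although the
variance may (`IsRankSet.muVec_add_mul_sqrt_le`). In both, `√V - √W ≤ (V - W) / √V` bounds the loss
in standard deviation, and conditions 2 and 3 say that the gain in mean eventually exceeds `c` times
this loss. The bound `div_le_setVar` puts the information sums below the variances under the root.

The exact values in (a) come from separability: constraints and objective split over the matched
sets, so optimal laws can be chosen set by set, and optimizing over index sets amounts to choosing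
the `k` smallest gaps. -/

lemma norm_prod_sub_prod_le_sum {ι : Type*} (s : Finset ι) (a b : ι → ℂ)
    (ha : ∀ i ∈ s, ‖a i‖ ≤ 1) (hb : ∀ i ∈ s, ‖b i‖ ≤ 1) :
    ‖∏ i ∈ s, a i - ∏ i ∈ s, b i‖ ≤ ∑ i ∈ s, ‖a i - b i‖ := by
  classical
  induction s using Finset.induction_on with
  | empty => simp
  | insert i s his ih =>
    rw [Finset.prod_insert his, Finset.prod_insert his, Finset.sum_insert his]
    have hprod : ‖∏ j ∈ s, b j‖ ≤ 1 := by
      rw [norm_prod]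
      exact Finset.prod_le_one (fun _ _ => norm_nonneg _)
        fun j hj => hb j (Finset.mem_insert_of_mem hj)
    have h := ih (fun j hj => ha j (Finset.mem_insert_of_mem hj))
      fun j hj => hb j (Finset.mem_insert_of_mem hj)
    calc ‖a i * ∏ j ∈ s, a j - b i * ∏ j ∈ s, b j‖
        = ‖(a i - b i) * ∏ j ∈ s, b j + a i * (∏ j ∈ s, a j - ∏ j ∈ s, b j)‖ := by ring_nf
      _ ≤ ‖a i - b i‖ * ‖∏ j ∈ s, b j‖ + ‖a i‖ * ‖∏ j ∈ s, a j - ∏ j ∈ s, b j‖ := by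
        refine (norm_add_le _ _).trans ?_
        rw [norm_mul, norm_mul]
      _ ≤ ‖a i - b i‖ * 1 + 1 * ∑ j ∈ s, ‖a j - b j‖ := by
        gcongr
        exact ha i (Finset.mem_insert_self _ _)
      _ = _ := by ring

section CharFun

variable {Ω : Type*} [MeasurableSpace Ω] {P : Measure Ω} [IsProbabilityMeasure P]

/-- Both functions are close to `1 - t² s / 2`, with `s` the second moment. The error keeps a factor
`s`, so that summing over a row of the array costs only the total variance. -/
lemma norm_charFun_sub_exp_le_of_bounded {X : Ω → ℝ} (hX : Measurable X) {b t : ℝ}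
    (hb : ∀ ω, |X ω| ≤ b) (hmean : ∫ ω, X ω ∂P = 0) (ht : |t| * b ≤ 1) :
    ‖charFun (P.map X) t - Complex.exp (-(t ^ 2 * ∫ ω, X ω ^ 2 ∂P) / 2 : ℝ)‖ ≤
      (|t| ^ 3 * b + t ^ 4 * b ^ 2) * ∫ ω, X ω ^ 2 ∂P := by
  set s := ∫ ω, X ω ^ 2 ∂P with hs
  have hb0 : 0 ≤ b := by
    obtain ⟨ω⟩ := nonempty_of_isProbabilityMeasure P
    exact (abs_nonneg _).trans (hb ω)
  have hint {f : Ω → ℝ} (hf : Measurable f) (C : ℝ) (hC : ∀ ω, |f ω| ≤ C) : Integrable f P :=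
    Integrable.of_bound hf.aestronglyMeasurable C (ae_of_all _ hC)
  have hX1 : Integrable X P := hint hX b hb
  have hsq (ω : Ω) : X ω ^ 2 ≤ b ^ 2 := sq_le_sq' (by linarith [(abs_le.1 (hb ω)).1])
    (abs_le.1 (hb ω)).2
  have hX2 : Integrable (fun ω => X ω ^ 2) P :=
    hint (hX.pow_const 2) (b ^ 2) fun ω => by rw [abs_of_nonneg (sq_nonneg _)]; exact hsq ω
  have hs0 : 0 ≤ s := integral_nonneg fun ω => sq_nonneg _
  have hsb : s ≤ b ^ 2 := by
    calc s ≤ ∫ _, b ^ 2 ∂P := integral_mono hX2 (integrable_const _) hsq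
      _ = b ^ 2 := by simp
  have htaylor (ω : Ω) :
      ‖Complex.exp (t * X ω * Complex.I) - (1 + t * X ω * Complex.I - ((t ^ 2 / 2 * X ω ^ 2 : ℝ) : ℂ))‖ ≤
        |t| ^ 3 * b * X ω ^ 2 := by
    have hn : ‖(t * X ω * Complex.I : ℂ)‖ = |t| * |X ω| := by simp
    have hle : |t| * |X ω| ≤ 1 :=
      (mul_le_mul_of_nonneg_left (hb ω) (abs_nonneg _)).trans ht
    have h := Complex.exp_bound (x := t * X ω * Complex.I) (by rw [hn]; exact hle)
      (n := 3) (by norm_num)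
    rw [hn] at h
    have he : ∑ m ∈ Finset.range 3, (t * X ω * Complex.I : ℂ) ^ m / (m.factorial : ℂ) =
        1 + t * X ω * Complex.I - ((t ^ 2 / 2 * X ω ^ 2 : ℝ) : ℂ) := by
      simp only [Finset.sum_range_succ, Finset.sum_range_zero, mul_pow, Complex.I_sq]
      push_cast [Nat.factorial]
      ring
    rw [he] at h
    refine h.trans ?_
    have h3 : (|t| * |X ω|) ^ 3 ≤ |t| ^ 3 * b * X ω ^ 2 := by
      have : (|t| * |X ω|) ^ 3 = |t| ^ 3 * |X ω| * X ω ^ 2 := by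
        rw [← sq_abs (X ω)]; ring
      rw [this]
      gcongr
      exact hb ω
    refine le_trans ?_ h3
    have h0 : 0 ≤ (|t| * |X ω|) ^ 3 := by positivity
    norm_num [Nat.factorial]
    linarith
  have hlin : ∫ ω, ((1 : ℂ) + t * X ω * Complex.I - ((t ^ 2 / 2 * X ω ^ 2 : ℝ) : ℂ)) ∂P =
      ((1 - t ^ 2 / 2 * s : ℝ) : ℂ) := by
    have i1 : Integrable (fun ω => (t * X ω * Complex.I : ℂ)) P :=
      (hX1.ofReal.const_mul _).mul_const _
    have i2 : Integrable (fun ω => ((t ^ 2 / 2 * X ω ^ 2 : ℝ) : ℂ)) P :=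
      (hX2.const_mul _).ofReal
    have i0 : Integrable (fun ω => (1 : ℂ) + t * X ω * Complex.I) P :=
      (integrable_const _).add i1
    rw [integral_sub i0 i2, integral_add (integrable_const _) i1,
      integral_mul_const, integral_const_mul, integral_complex_ofReal, hmean,
      integral_complex_ofReal, integral_const_mul]
    simp [hs]
  have hexp : Integrable (fun ω => Complex.exp (t * X ω * Complex.I)) P := by
    refine Integrable.of_bound (by fun_prop) 1 (ae_of_all _ fun ω => ?_)
    rw [← Complex.ofReal_mul, Complex.norm_exp_ofReal_mul_I]
  have hchar : ‖charFun (P.map X) t - ((1 - t ^ 2 / 2 * s : ℝ) : ℂ)‖ ≤ |t| ^ 3 * b * s := by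
    rw [charFun_apply_real, integral_map hX.aemeasurable (by fun_prop), ← hlin,
      ← integral_sub hexp]
    · refine (norm_integral_le_integral_norm _).trans ?_
      rw [hs, ← integral_const_mul]
      exact integral_mono_of_nonneg (ae_of_all _ fun _ => norm_nonneg _)
        (hX2.const_mul _) (ae_of_all _ htaylor)
    · exact ((integrable_const _).add ((hX1.ofReal.const_mul _).mul_const _)).sub
        (hX2.const_mul _).ofReal
  have hy : t ^ 2 * b ^ 2 ≤ 1 := by
    rw [← sq_abs t, ← mul_pow]
    exact pow_le_one₀ (by positivity) ht
  have hys : t ^ 2 * s ≤ t ^ 2 * b ^ 2 := by gcongr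
  have hreal : |Real.exp (-(t ^ 2 * s) / 2) - (1 - t ^ 2 / 2 * s)| ≤ t ^ 4 * b ^ 2 * s := by
    have h0 : 0 ≤ t ^ 2 * s := by positivity
    have h := Real.abs_exp_sub_one_sub_id_le (x := -(t ^ 2 * s) / 2)
      (by rw [abs_le]; constructor <;> linarith)
    -- The quadratic remainder contains `s²`; one factor is traded for `b²`.
    have h1 : (-(t ^ 2 * s) / 2) ^ 2 ≤ t ^ 4 * b ^ 2 * s := by
      have : (t ^ 2 * s) * (t ^ 2 * s) ≤ (t ^ 2 * s) * (t ^ 2 * b ^ 2) := by gcongr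
      nlinarith
    refine le_trans (le_of_eq ?_) (h.trans h1)
    ring_nf
  calc ‖charFun (P.map X) t - Complex.exp (-(t ^ 2 * s) / 2 : ℝ)‖
      ≤ ‖charFun (P.map X) t - ((1 - t ^ 2 / 2 * s : ℝ) : ℂ)‖ +
        ‖Complex.exp (-(t ^ 2 * s) / 2 : ℝ) - ((1 - t ^ 2 / 2 * s : ℝ) : ℂ)‖ := by
        rw [norm_sub_rev (Complex.exp _)]
        exact norm_sub_le_norm_sub_add_norm_sub _ _ _
    _ ≤ |t| ^ 3 * b * s + t ^ 4 * b ^ 2 * s := by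
        refine add_le_add hchar ?_
        rw [← Complex.ofReal_exp, ← Complex.ofReal_sub, Complex.norm_real]
        exact hreal
    _ = _ := by ring

/-- Since the variances add up to one, the Gaussian factorizes along the same index set, and the two
products of numbers in the unit disc are compared factor by factor. -/
lemma norm_charFun_sum_sub_exp_le_of_bounded {ι : Type*} [Fintype ι] {X : ι → Ω → ℝ}
    (hX : ∀ i, Measurable (X i)) (hindep : iIndepFun X P) {b t : ℝ} (hb : ∀ i ω, |X i ω| ≤ b)
    (hmean : ∀ i, ∫ ω, X i ω ∂P = 0) (hvar : ∑ i, ∫ ω, X i ω ^ 2 ∂P = 1) (ht : |t| * b ≤ 1) :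
    ‖charFun (P.map fun ω => ∑ i, X i ω) t - Complex.exp (-t ^ 2 / 2)‖ ≤
      |t| ^ 3 * b + t ^ 4 * b ^ 2 := by
  have hprob (i : ι) : IsProbabilityMeasure (P.map (X i)) :=
    Measure.isProbabilityMeasure_map (hX i).aemeasurable
  have hexp : Complex.exp (-t ^ 2 / 2) =
      ∏ i, Complex.exp (-(t ^ 2 * ∫ ω, X i ω ^ 2 ∂P) / 2 : ℝ) := by
    rw [← Complex.exp_sum, ← Complex.ofReal_sum, ← Finset.sum_div, Finset.sum_neg_distrib,
      ← Finset.mul_sum, hvar]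
    push_cast
    ring_nf
  rw [hindep.charFun_map_fun_sum_eq_prod fun i => (hX i).aemeasurable, Finset.prod_apply, hexp]
  refine (norm_prod_sub_prod_le_sum _ _ _ (fun i _ => norm_charFun_le_one t)
    fun i _ => ?_).trans ?_
  · rw [← Complex.ofReal_exp, Complex.norm_real, Real.norm_of_nonneg (Real.exp_nonneg _),
      Real.exp_le_one_iff]
    have : 0 ≤ t ^ 2 * ∫ ω, X i ω ^ 2 ∂P :=
      mul_nonneg (sq_nonneg _) (integral_nonneg fun ω => sq_nonneg _)
    linarith
  · refine (Finset.sum_le_sum fun i _ =>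
      norm_charFun_sub_exp_le_of_bounded (hX i) (hb i) (hmean i) ht).trans ?_
    rw [← Finset.mul_sum, hvar, mul_one]

end CharFun

lemma gaussianReal_real_Ici (c : ℝ) :
    (gaussianReal 0 1).real (Set.Ici c) = 1 - cdf (gaussianReal 0 1) c := by
  have : NullSingletonClass (gaussianReal 0 1) := nullSingletonClass_gaussianReal one_ne_zero
  rw [cdf_eq_real, ← probReal_compl_eq_one_sub measurableSet_Iic, Set.compl_Iic]
  exact measureReal_congr Ioi_ae_eq_Ici.symm

/-- Lindeberg's central limit theorem for triangular arrays of uniformly small independent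
variables, as convergence of upper tails. -/
theorem tendsto_measureReal_sum_ge_of_bounded {Ω : ℕ → Type*} [∀ n, MeasurableSpace (Ω n)]
    {P : (n : ℕ) → Measure (Ω n)} [∀ n, IsProbabilityMeasure (P n)] {ι : ℕ → Type*}
    [∀ n, Fintype (ι n)] {X : (n : ℕ) → ι n → Ω n → ℝ} (hX : ∀ n i, Measurable (X n i))
    (hindep : ∀ n, iIndepFun (X n) (P n)) {b : ℕ → ℝ} (hb : ∀ n i ω, |X n i ω| ≤ b n)
    (hmean : ∀ n i, ∫ ω, X n i ω ∂(P n) = 0)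
    (hvar : ∀ᶠ n in atTop, ∑ i, ∫ ω, X n i ω ^ 2 ∂(P n) = 1)
    (hb0 : Tendsto b atTop (𝓝 0)) (c : ℝ) :
    Tendsto (fun n => (P n).real {ω | c ≤ ∑ i, X n i ω}) atTop
      (𝓝 (1 - cdf (gaussianReal 0 1) c)) := by
  have hmeas (n : ℕ) : Measurable fun ω => ∑ i, X n i ω :=
    Finset.measurable_sum _ fun i _ => hX n i
  let μs : ℕ → ProbabilityMeasure ℝ := fun n =>
    ⟨(P n).map fun ω => ∑ i, X n i ω, Measure.isProbabilityMeasure_map (hmeas n).aemeasurable⟩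
  let μ : ProbabilityMeasure ℝ := ⟨gaussianReal 0 1, inferInstance⟩
  have hlim : Tendsto μs atTop (𝓝 μ) := by
    refine ProbabilityMeasure.tendsto_iff_tendsto_charFun.2 fun t => ?_
    have hgauss : charFun (μ : Measure ℝ) t = Complex.exp (-t ^ 2 / 2) := by
      change charFun (gaussianReal 0 1) t = _
      rw [charFun_gaussianReal]
      simp [neg_div]
    rw [hgauss, tendsto_iff_norm_sub_tendsto_zero]
    have hbound : Tendsto (fun n => |t| ^ 3 * b n + t ^ 4 * b n ^ 2) atTop (𝓝 0) := by
      simpa using (hb0.const_mul (|t| ^ 3)).add ((hb0.pow 2).const_mul (t ^ 4))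
    have hsmall : ∀ᶠ n in atTop, |t| * b n ≤ 1 := by
      have : Tendsto (fun n => |t| * b n) atTop (𝓝 0) := by simpa using hb0.const_mul |t|
      exact (this.eventually_lt_const zero_lt_one).mono fun _ h => h.le
    refine squeeze_zero' (Eventually.of_forall fun _ => norm_nonneg _) ?_ hbound
    filter_upwards [hvar, hsmall] with n h1 h2
    exact norm_charFun_sum_sub_exp_le_of_bounded (hX n) (hindep n) (hb n) (hmean n) h1 h2
  have hnull : (μ : Measure ℝ) (frontier (Set.Ici c)) = 0 := by
    have : NullSingletonClass (gaussianReal 0 1) := nullSingletonClass_gaussianReal one_ne_zero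
    rw [frontier_Ici]
    exact measure_singleton (μ := gaussianReal 0 1) c
  have h := (ENNReal.tendsto_toReal (measure_ne_top (μ : Measure ℝ) (Set.Ici c))).comp
    (ProbabilityMeasure.tendsto_measure_of_null_frontier_of_tendsto' hlim hnull)
  rw [← gaussianReal_real_Ici]
  refine h.congr fun n => ?_
  change ((P n).map (fun ω => ∑ i, X n i ω) (Set.Ici c)).toReal = _
  rw [Measure.map_apply (hmeas n) measurableSet_Ici]
  rfl

lemma gaussianReal_real_Ici_add_mul_sqrt (m c : ℝ) {v : ℝ} (hv : 0 < v) :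
    (gaussianReal m v.toNNReal).real (Set.Ici (m + c * √v)) = 1 - cdf (gaussianReal 0 1) c := by
  have hs : 0 < √v := Real.sqrt_pos.2 hv
  have hmap : gaussianReal m v.toNNReal =
      ((gaussianReal 0 1).map (√v * ·)).map (m + ·) := by
    rw [gaussianReal_map_const_mul, gaussianReal_map_const_add]
    congr 1
    · simp
    · ext
      simp [Real.sq_sqrt hv.le, hv.le]
  rw [← gaussianReal_real_Ici, hmap, Measure.real, Measure.map_apply (by fun_prop)
    measurableSet_Ici, Measure.map_apply (by fun_prop) (by measurability)]
  congr 2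
  ext x
  simp only [Set.mem_preimage, Set.mem_Ici, add_le_add_iff_left]
  rw [mul_comm, mul_le_mul_iff_right₀ hs]

/-! ### The laws of one matched set under a sensitivity model -/

section SensLaws

variable {m : ℕ}

lemma sensLaws_top : sensLaws m ⊤ = stdSimplex ℝ (Fin m) := by
  ext p
  simp [sensLaws]

lemma sensLaws_of_ne_top {Γ : ℝ≥0∞} (hΓ : Γ ≠ ⊤) :
    sensLaws m Γ = sensProb Γ.toReal '' Set.univ.pi fun _ => Set.Icc (0 : ℝ) 1 := by
  ext p
  simp only [sensLaws, hΓ, Set.mem_ofPred_eq, false_and, false_or, ne_eq, not_false_eq_true,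
    true_and, Set.mem_image, Set.mem_univ_pi, eq_comm]

lemma sensLaws_ofReal {Γ : ℝ} (hΓ : 0 ≤ Γ) :
    sensLaws m (ENNReal.ofReal Γ) = sensProb Γ '' Set.univ.pi fun _ => Set.Icc (0 : ℝ) 1 := by
  rw [sensLaws_of_ne_top ENNReal.ofReal_ne_top, ENNReal.toReal_ofReal hΓ]

lemma sum_exp_pos [NeZero m] (f : Fin m → ℝ) : 0 < ∑ l, Real.exp (f l) :=
  Finset.sum_pos (fun _ _ => Real.exp_pos _) Finset.univ_nonempty

lemma sensProb_mem_stdSimplex [NeZero m] (Γ : ℝ) (u : Fin m → ℝ) :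
    sensProb Γ u ∈ stdSimplex ℝ (Fin m) := by
  refine ⟨fun j => div_nonneg (Real.exp_nonneg _) (sum_exp_pos _).le, ?_⟩
  simp only [sensProb, ← Finset.sum_div]
  exact div_self (sum_exp_pos _).ne'

lemma sensLaws_subset_stdSimplex [NeZero m] (Γ : ℝ≥0∞) :
    sensLaws m Γ ⊆ stdSimplex ℝ (Fin m) := by
  by_cases hΓ : Γ = ⊤
  · rw [hΓ, sensLaws_top]
  · rw [sensLaws_of_ne_top hΓ]
    rintro _ ⟨u, -, rfl⟩
    exact sensProb_mem_stdSimplex _ u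

lemma continuous_sensProb [NeZero m] (Γ : ℝ) : Continuous (sensProb (m := m) Γ) := by
  refine continuous_pi fun j => ?_
  unfold sensProb
  exact Continuous.div (by fun_prop) (by fun_prop) fun u => (sum_exp_pos _).ne'

lemma isCompact_sensLaws [NeZero m] (Γ : ℝ≥0∞) : IsCompact (sensLaws m Γ) := by
  by_cases hΓ : Γ = ⊤
  · rw [hΓ, sensLaws_top]
    exact isCompact_stdSimplex ℝ _
  · rw [sensLaws_of_ne_top hΓ]
    exact (isCompact_univ_pi fun _ => isCompact_Icc).image (continuous_sensProb _)

lemma sensLaws_nonempty [NeZero m] (Γ : ℝ≥0∞) : (sensLaws m Γ).Nonempty := by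
  by_cases hΓ : Γ = ⊤
  · rw [hΓ, sensLaws_top]
    exact ⟨_, single_mem_stdSimplex ℝ 0⟩
  · rw [sensLaws_of_ne_top hΓ]
    exact Set.Nonempty.image _ ⟨fun _ => 0, fun _ _ => by simp⟩

/-- Every weight `Γ ^ u` lies in `[1, Γ]`. -/
lemma inv_mul_le_of_mem_sensLaws [NeZero m] {Γ : ℝ} (hΓ : 1 ≤ Γ) {p : Fin m → ℝ}
    (hp : p ∈ sensLaws m (ENNReal.ofReal Γ)) (j : Fin m) : (m * Γ)⁻¹ ≤ p j := by
  rw [sensLaws_ofReal (zero_le_one.trans hΓ)] at hp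
  obtain ⟨u, hu, rfl⟩ := hp
  have hlog : 0 ≤ Real.log Γ := Real.log_nonneg hΓ
  have hsum : ∑ l, Real.exp (Real.log Γ * u l) ≤ m * Γ := by
    calc ∑ l, Real.exp (Real.log Γ * u l) ≤ ∑ _l : Fin m, Γ := by
          refine Finset.sum_le_sum fun l _ => ?_
          calc Real.exp (Real.log Γ * u l) ≤ Real.exp (Real.log Γ) :=
                Real.exp_le_exp.2 (mul_le_of_le_one_right hlog (hu l trivial).2)
            _ = Γ := Real.exp_log (by linarith)
      _ = m * Γ := by simp
  have hone : 1 ≤ Real.exp (Real.log Γ * u j) :=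
    Real.one_le_exp (mul_nonneg hlog (hu j trivial).1)
  rw [sensProb, ← one_div]
  exact div_le_div₀ (zero_le_one.trans hone) hone (sum_exp_pos _) hsum

/-- The confounder is `u j = log (p j / min p) / log Γ`. This turns a bound on the true probability
ratios into membership in a sensitivity model. -/
lemma mem_sensLaws_of_le_mul [NeZero m] {Γ : ℝ} (hΓ : 1 ≤ Γ) {p : Fin m → ℝ}
    (hp : p ∈ stdSimplex ℝ (Fin m)) (hle : ∀ j l, p j ≤ Γ * p l) :
    p ∈ sensLaws m (ENNReal.ofReal Γ) := by
  have hΓ0 : 0 < Γ := by linarith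
  rw [sensLaws_ofReal hΓ0.le]
  obtain ⟨a, -, ha⟩ := Finset.exists_min_image Finset.univ p Finset.univ_nonempty
  replace ha (j : Fin m) : p a ≤ p j := ha j (Finset.mem_univ _)
  have hpa : 0 < p a := by
    refine lt_of_le_of_ne (hp.1 a) fun h0 => ?_
    have hz : ∀ j ∈ Finset.univ, p j = 0 := fun j _ =>
      le_antisymm (by simpa [← h0] using hle j a) (hp.1 j)
    simpa [Finset.sum_eq_zero hz] using hp.2
  have hratio1 (j : Fin m) : 1 ≤ p j / p a := (one_le_div hpa).2 (ha j)
  have hratioΓ (j : Fin m) : p j / p a ≤ Γ := (div_le_iff₀ hpa).2 (hle j a)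
  have hexp (j : Fin m) :
      Real.exp (Real.log Γ * (Real.log (p j / p a) / Real.log Γ)) = p j / p a := by
    have hpos : 0 < p j / p a := by linarith [hratio1 j]
    -- For `Γ = 1` the quotient by `log Γ = 0` is zero by convention, which is right because all
    -- ratios are then one.
    rcases eq_or_lt_of_le hΓ with h1 | h1
    · have : p j / p a = 1 := le_antisymm (h1 ▸ hratioΓ j) (hratio1 j)
      simp [this]
    · rw [mul_div_cancel₀ _ (Real.log_pos h1).ne', Real.exp_log hpos]
  refine ⟨fun j => Real.log (p j / p a) / Real.log Γ, fun j _ => ⟨?_, ?_⟩, ?_⟩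
  · exact div_nonneg (Real.log_nonneg (hratio1 j)) (Real.log_nonneg hΓ)
  · exact div_le_one_of_le₀ (Real.log_le_log (by linarith [hratio1 j]) (hratioΓ j))
      (Real.log_nonneg hΓ)
  · funext j
    simp only [sensProb, hexp, ← Finset.sum_div, hp.2]
    field_simp

end SensLaws

namespace MatchedStudy

variable {I : ℕ} {Ω : Type*} [MeasurableSpace Ω] (S : MatchedStudy I Ω)

instance neZero_n (i : Fin I) : NeZero (S.n i) := ⟨by have := S.two_le_n i; omega⟩

/-! ### Maximized means and variances of one matched set -/

lemma continuous_setMean (i : Fin I) : Continuous (S.setMean i) := by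
  unfold setMean
  fun_prop

lemma continuous_setVar (i : Fin I) : Continuous (S.setVar i) := by
  have := S.continuous_setMean i
  unfold setVar
  fun_prop

lemma setMean_le_muSet (i : Fin I) {Γ : ℝ≥0∞} {p : Fin (S.n i) → ℝ}
    (hp : p ∈ sensLaws (S.n i) Γ) : S.setMean i p ≤ S.muSet i Γ :=
  le_csSup ((isCompact_sensLaws Γ).image (S.continuous_setMean i)).bddAbove
    (Set.mem_image_of_mem _ hp)

lemma isCompact_maximizers (i : Fin I) (Γ : ℝ≥0∞) :
    IsCompact {p | p ∈ sensLaws (S.n i) Γ ∧ S.setMean i p = S.muSet i Γ} :=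
  (isCompact_sensLaws Γ).inter_right
    (isClosed_eq (S.continuous_setMean i) continuous_const)

lemma maximizers_nonempty (i : Fin I) (Γ : ℝ≥0∞) :
    {p | p ∈ sensLaws (S.n i) Γ ∧ S.setMean i p = S.muSet i Γ}.Nonempty := by
  obtain ⟨p, hp, h⟩ := ((isCompact_sensLaws Γ).image (S.continuous_setMean i)).sSup_mem
    ((sensLaws_nonempty Γ).image _)
  exact ⟨p, hp, h⟩

lemma setVar_le_varSet (i : Fin I) {Γ : ℝ≥0∞} {p : Fin (S.n i) → ℝ}
    (hp : p ∈ sensLaws (S.n i) Γ) (hmean : S.setMean i p = S.muSet i Γ) :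
    S.setVar i p ≤ S.varSet i Γ :=
  le_csSup ((S.isCompact_maximizers i Γ).image (S.continuous_setVar i)).bddAbove
    (Set.mem_image_of_mem _ ⟨hp, hmean⟩)

lemma exists_setMean_eq_setVar_eq (i : Fin I) (Γ : ℝ≥0∞) :
    ∃ p ∈ sensLaws (S.n i) Γ, S.setMean i p = S.muSet i Γ ∧ S.setVar i p = S.varSet i Γ := by
  obtain ⟨p, hp, h⟩ := ((S.isCompact_maximizers i Γ).image (S.continuous_setVar i)).sSup_mem
    ((S.maximizers_nonempty i Γ).image _)
  exact ⟨p, hp.1, hp.2, h⟩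

lemma setVar_nonneg (i : Fin I) {p : Fin (S.n i) → ℝ} (hp : p ∈ stdSimplex ℝ (Fin (S.n i))) :
    0 ≤ S.setVar i p :=
  Finset.sum_nonneg fun j _ => mul_nonneg (hp.1 j) (sq_nonneg _)

lemma varSet_nonneg (i : Fin I) (Γ : ℝ≥0∞) : 0 ≤ S.varSet i Γ := by
  obtain ⟨p, hp, -, h⟩ := S.exists_setMean_eq_setVar_eq i Γ
  exact h ▸ S.setVar_nonneg i (sensLaws_subset_stdSimplex Γ hp)

lemma q0_le_iSup (i : Fin I) (j : Fin (S.n i)) : S.q0 i j ≤ ⨆ j, S.q0 i j :=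
  le_ciSup (Set.finite_range _).bddAbove j

lemma iInf_le_q0 (i : Fin I) (j : Fin (S.n i)) : ⨅ j, S.q0 i j ≤ S.q0 i j :=
  ciInf_le (Set.finite_range _).bddBelow j

lemma iSup_sub_setMean (i : Fin I) {p : Fin (S.n i) → ℝ}
    (hp : p ∈ stdSimplex ℝ (Fin (S.n i))) :
    (⨆ j, S.q0 i j) - S.setMean i p = ∑ j, p j * ((⨆ j, S.q0 i j) - S.q0 i j) := by
  simp only [mul_sub, Finset.sum_sub_distrib, ← Finset.sum_mul, hp.2, one_mul, setMean]

lemma muSet_top (i : Fin I) : S.muSet i ⊤ = ⨆ j, S.q0 i j := by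
  apply le_antisymm
  · obtain ⟨p, hp, h, -⟩ := S.exists_setMean_eq_setVar_eq i ⊤
    rw [sensLaws_top] at hp
    rw [← h, ← sub_nonneg, S.iSup_sub_setMean i hp]
    exact Finset.sum_nonneg fun j _ => mul_nonneg (hp.1 j) (sub_nonneg.2 (S.q0_le_iSup i j))
  · refine ciSup_le fun j => ?_
    have h := S.setMean_le_muSet i (Γ := ⊤) (p := Pi.single j 1)
      (by rw [sensLaws_top]; exact single_mem_stdSimplex ℝ j)
    simpa [setMean, Pi.single_apply] using h

/-- A mean-maximizing law charges only units with the maximal score, so the statistic is almost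
surely constant. -/
lemma varSet_top (i : Fin I) : S.varSet i ⊤ = 0 := by
  obtain ⟨p, hp, hmean, hvar⟩ := S.exists_setMean_eq_setVar_eq i ⊤
  rw [sensLaws_top] at hp
  rw [muSet_top] at hmean
  have h := S.iSup_sub_setMean i hp
  rw [hmean, sub_self, eq_comm, Finset.sum_eq_zero_iff_of_nonneg fun j _ =>
    mul_nonneg (hp.1 j) (sub_nonneg.2 (S.q0_le_iSup i j))] at h
  rw [← hvar, setVar, hmean]
  refine Finset.sum_eq_zero fun j hj => ?_
  linear_combination (S.q0 i j - ⨆ j, S.q0 i j) * (-h j hj)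

lemma abs_q0_sub_setMean_le (i : Fin I) {p : Fin (S.n i) → ℝ}
    (hp : p ∈ stdSimplex ℝ (Fin (S.n i))) (j : Fin (S.n i)) :
    |S.q0 i j - S.setMean i p| ≤ S.R i := by
  have hup : S.setMean i p ≤ ⨆ j, S.q0 i j := by
    rw [← muSet_top]
    exact S.setMean_le_muSet i (by rwa [sensLaws_top])
  have hlow : ⨅ j, S.q0 i j ≤ S.setMean i p := by
    calc ⨅ j, S.q0 i j = ∑ j, p j * ⨅ j, S.q0 i j := by rw [← Finset.sum_mul, hp.2, one_mul]
      _ ≤ S.setMean i p :=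
        Finset.sum_le_sum fun j _ => mul_le_mul_of_nonneg_left (S.iInf_le_q0 i j) (hp.1 j)
  have h1 := S.q0_le_iSup i j
  have h2 := S.iInf_le_q0 i j
  rw [abs_le, R]
  constructor <;> linarith

/-- The units with extreme scores have mass at least `1 / (n Γ)` each, and their squared deviations
from any centre add up to at least `R² / 2`. The cube is weaker than what this gives, since `n Γ ≥
2`. -/
lemma div_le_setVar (i : Fin I) {Γ : ℝ} (hΓ : 1 ≤ Γ) {p : Fin (S.n i) → ℝ}
    (hp : p ∈ sensLaws (S.n i) (ENNReal.ofReal Γ)) :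
    S.R i ^ 2 / (S.n i * Γ) ^ 3 ≤ S.setVar i p := by
  have hsimplex := sensLaws_subset_stdSimplex _ hp
  have hlow := inv_mul_le_of_mem_sensLaws hΓ hp
  have hn : (2 : ℝ) ≤ S.n i := by exact_mod_cast S.two_le_n i
  have hx : 2 ≤ S.n i * Γ := by nlinarith
  obtain ⟨a, ha⟩ := exists_eq_ciSup_of_finite (f := S.q0 i)
  obtain ⟨b, hb⟩ := exists_eq_ciInf_of_finite (f := S.q0 i)
  have hR : S.R i = S.q0 i a - S.q0 i b := by rw [R, ha, hb]
  set x := S.n i * Γ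
  set M := S.setMean i p
  have hterm (j : Fin (S.n i)) : x⁻¹ * (S.q0 i j - M) ^ 2 ≤ p j * (S.q0 i j - M) ^ 2 :=
    mul_le_mul_of_nonneg_right (hlow j) (sq_nonneg _)
  have hinv : 0 < x⁻¹ := by positivity
  have hcube : S.R i ^ 2 / x ^ 3 ≤ x⁻¹ * (S.R i ^ 2 / 2) := by
    rw [div_le_iff₀ (by positivity)]
    have : x⁻¹ * (S.R i ^ 2 / 2) * x ^ 3 = S.R i ^ 2 * (x ^ 2 / 2) := by field_simp
    rw [this]
    exact le_mul_of_one_le_right (sq_nonneg _) (by nlinarith)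
  -- The two-point sum below needs distinct units; coinciding extremes mean `R = 0`.
  by_cases hab : a = b
  · have : S.R i = 0 := by rw [hR, hab, sub_self]
    simpa [this] using S.setVar_nonneg i hsimplex
  calc S.R i ^ 2 / x ^ 3 ≤ x⁻¹ * (S.R i ^ 2 / 2) := hcube
    _ ≤ x⁻¹ * (S.q0 i a - M) ^ 2 + x⁻¹ * (S.q0 i b - M) ^ 2 := by
      rw [← mul_add, hR]
      gcongr
      nlinarith [sq_nonneg (S.q0 i a - M + (S.q0 i b - M))]
    _ ≤ p a * (S.q0 i a - M) ^ 2 + p b * (S.q0 i b - M) ^ 2 := add_le_add (hterm a) (hterm b)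
    _ = ∑ j ∈ {a, b}, p j * (S.q0 i j - M) ^ 2 :=
      (Finset.sum_pair (f := fun j => p j * (S.q0 i j - M) ^ 2) hab).symm
    _ ≤ S.setVar i p := Finset.sum_le_sum_of_subset_of_nonneg (Finset.subset_univ _)
      fun j _ _ => mul_nonneg (hsimplex.1 j) (sq_nonneg _)

/-! ### Mean and variance of the whole statistic under independent assignments -/

/-- Independence in algebraic form. Taking all factors but one or two equal to `1` yields the
marginals used below. -/
lemma expect_prod (p : (i : Fin I) → Fin (S.n i) → ℝ) (h : (i : Fin I) → Fin (S.n i) → ℝ) :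
    S.expect p (fun z => ∏ i, h i (z i)) = ∏ i, ∑ j, p i j * h i j := by
  rw [Finset.prod_univ_sum, Fintype.piFinset_univ]
  simp only [expect, Finset.prod_mul_distrib]

lemma expect_sum {ι : Type*} (s : Finset ι) (p : (i : Fin I) → Fin (S.n i) → ℝ)
    (f : ι → S.Assign → ℝ) :
    S.expect p (fun z => ∑ a ∈ s, f a z) = ∑ a ∈ s, S.expect p (f a) := by
  simp only [expect, Finset.mul_sum]
  exact Finset.sum_comm

lemma expect_apply {p : (i : Fin I) → Fin (S.n i) → ℝ} (hp : ∀ i, ∑ j, p i j = 1) (i : Fin I)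
    (g : Fin (S.n i) → ℝ) : S.expect p (fun z => g (z i)) = ∑ j, p i j * g j := by
  have h := S.expect_prod p (Function.update (fun _ _ => 1) i g)
  have h1 (z : S.Assign) :
      ∏ l, Function.update (fun (l : Fin I) (_ : Fin (S.n l)) => (1 : ℝ)) i g l (z l) = g (z i) := by
    rw [Finset.prod_eq_single i (fun l _ hl => by simp [hl]) (by simp)]
    simp
  simp only [h1] at h
  rw [h, Finset.prod_eq_single i (fun l _ hl => by simp [hl, hp]) (by simp)]
  simp

lemma expect_mul_apply {p : (i : Fin I) → Fin (S.n i) → ℝ} (hp : ∀ i, ∑ j, p i j = 1)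
    {i l : Fin I} (hil : i ≠ l) (g : (i : Fin I) → Fin (S.n i) → ℝ) :
    S.expect p (fun z => g i (z i) * g l (z l)) = (∑ j, p i j * g i j) * ∑ j, p l j * g l j := by
  have h := S.expect_prod p fun a => if a = i ∨ a = l then g a else fun _ => 1
  have hprod (f : Fin I → ℝ) (hf : ∀ a, a ≠ i → a ≠ l → f a = 1) : ∏ a, f a = f i * f l := by
    rw [← Finset.prod_pair hil]
    refine (Finset.prod_subset (Finset.subset_univ _) fun a _ ha => ?_).symm
    simp only [Finset.mem_insert, Finset.mem_singleton, not_or] at ha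
    exact hf a ha.1 ha.2
  have h1 (z : S.Assign) : ∏ a, (if a = i ∨ a = l then g a else fun _ => 1) (z a) =
      g i (z i) * g l (z l) := by
    rw [hprod _ fun a hai hal => by simp [hai, hal]]
    simp
  simp only [h1] at h
  rw [h, hprod _ fun a hai hal => by simp [hai, hal, hp]]
  simp

lemma tset_eq (i : Fin I) (z : S.Assign) (y : (i : Fin I) → Fin (S.n i) → ℝ) :
    S.tset i z y = S.q y i (z i) := by
  simp [tset, ind]

lemma modelMean_eq_sum {p : (i : Fin I) → Fin (S.n i) → ℝ} (hp : ∀ i, ∑ j, p i j = 1) :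
    S.modelMean p = ∑ i, S.setMean i (p i) := by
  simp only [modelMean, t, tset_eq, expect_sum]
  exact Finset.sum_congr rfl fun i _ => S.expect_apply hp i (S.q0 i)

/-- In the square of the centred sum, the cross terms vanish by independence. -/
lemma modelVar_eq_sum {p : (i : Fin I) → Fin (S.n i) → ℝ} (hp : ∀ i, ∑ j, p i j = 1) :
    S.modelVar p = ∑ i, S.setVar i (p i) := by
  let g : (i : Fin I) → Fin (S.n i) → ℝ := fun i j => S.q0 i j - S.setMean i (p i)
  have hg (i : Fin I) : ∑ j, p i j * g i j = 0 := by
    simp only [g, mul_sub, Finset.sum_sub_distrib, ← Finset.sum_mul, hp, one_mul]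
    exact sub_self _
  have hsq (z : S.Assign) : (S.t z S.Y0 - S.modelMean p) ^ 2 =
      ∑ i, ∑ l, g i (z i) * g l (z l) := by
    have : S.t z S.Y0 - S.modelMean p = ∑ i, g i (z i) := by
      rw [S.modelMean_eq_sum hp, t, ← Finset.sum_sub_distrib]
      exact Finset.sum_congr rfl fun i _ => by rw [tset_eq]; rfl
    rw [this, sq, Finset.sum_mul_sum]
  simp only [modelVar, hsq, expect_sum]
  refine Finset.sum_congr rfl fun i _ => ?_
  rw [Finset.sum_eq_single i (fun l _ hl => by rw [S.expect_mul_apply hp hl.symm, hg, zero_mul])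
    (by simp), S.expect_apply hp i fun j => g i j * g i j]
  simp only [setVar, g, sq]

lemma sum_eq_one_of_mem_models {Γ : Fin I → ℝ≥0∞} {p : (i : Fin I) → Fin (S.n i) → ℝ}
    (hp : p ∈ S.models Γ) (i : Fin I) : ∑ j, p i j = 1 :=
  (sensLaws_subset_stdSimplex _ (hp i)).2

lemma exists_optimal_model (Γ : Fin I → ℝ≥0∞) :
    ∃ p ∈ S.models Γ, S.modelMean p = ∑ i, S.muSet i (Γ i) ∧
      S.modelVar p = ∑ i, S.varSet i (Γ i) := by
  choose p hp hmean hvar using fun i => S.exists_setMean_eq_setVar_eq i (Γ i)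
  have hsum := S.sum_eq_one_of_mem_models (Γ := Γ) hp
  exact ⟨p, hp, by simp only [S.modelMean_eq_sum hsum, hmean],
    by simp only [S.modelVar_eq_sum hsum, hvar]⟩

lemma muVec_eq_sum (Γ : Fin I → ℝ≥0∞) : S.muVec Γ = ∑ i, S.muSet i (Γ i) := by
  refine IsGreatest.csSup_eq ⟨?_, ?_⟩
  · obtain ⟨p, hp, h, -⟩ := S.exists_optimal_model Γ
    exact ⟨p, hp, h⟩
  · rintro _ ⟨p, hp, rfl⟩
    rw [S.modelMean_eq_sum (S.sum_eq_one_of_mem_models hp)]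
    exact Finset.sum_le_sum fun i _ => S.setMean_le_muSet i (hp i)

lemma varVec_eq_sum (Γ : Fin I → ℝ≥0∞) : S.varVec Γ = ∑ i, S.varSet i (Γ i) := by
  refine IsGreatest.csSup_eq ⟨?_, ?_⟩
  · obtain ⟨p, hp, hmean, hvar⟩ := S.exists_optimal_model Γ
    exact ⟨p, ⟨hp, by rw [hmean, muVec_eq_sum]⟩, hvar⟩
  · rintro _ ⟨p, ⟨hp, hmean⟩, rfl⟩
    have hsum := S.sum_eq_one_of_mem_models hp
    -- Equality of sums ordered term by term forces equality of the terms: a model maximizing the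
    -- total mean maximizes it in every set.
    rw [muVec_eq_sum, S.modelMean_eq_sum hsum, Finset.sum_eq_sum_iff_of_le fun i _ =>
      S.setMean_le_muSet i (hp i)] at hmean
    rw [S.modelVar_eq_sum hsum]
    exact Finset.sum_le_sum fun i hi => S.setVar_le_varSet i (hp i) (hmean i hi)

end MatchedStudy

/-! ### Exchanging index sets of equal cardinality -/

/-- The common part cancels, and each remaining element occurs in equally many pairs. Summing over
all pairs avoids choosing a bijection and matches the averages in the third condition. -/
lemma card_sdiff_mul_sum_sub_sum {ι : Type*} [DecidableEq ι] {J K : Finset ι}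
    (h : J.card = K.card) (f : ι → ℝ) :
    ((J \ K).card : ℝ) * (∑ i ∈ K, f i - ∑ i ∈ J, f i) =
      ∑ x ∈ (J \ K) ×ˢ (K \ J), (f x.2 - f x.1) := by
  have hJ := Finset.sum_inter_add_sum_sdiff J K f
  have hK := Finset.sum_inter_add_sum_sdiff K J f
  have hcard : (J \ K).card = (K \ J).card := Finset.card_sdiff_comm h
  rw [Finset.inter_comm] at hK
  rw [Finset.sum_product]
  simp only [Finset.sum_sub_distrib, Finset.sum_const, nsmul_eq_mul, ← Finset.mul_sum, ← hcard]
  rw [← hJ, ← hK]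
  ring

lemma card_sdiff_pos {ι : Type*} [DecidableEq ι] {J K : Finset ι}
    (h : J.card = K.card) (hne : J ≠ K) : 0 < ((J \ K).card : ℝ) := by
  rw [Nat.cast_pos, Finset.card_pos, Finset.sdiff_nonempty]
  exact fun hsub => hne (Finset.eq_of_subset_of_card_le hsub h.ge)

namespace MatchedStudy

variable {I : ℕ} {Ω : Type*} [MeasurableSpace Ω] (S : MatchedStudy I Ω)

/-! ### Maximization over the index sets -/

lemma sum_bound (Γ₀ : ℝ) (J : Finset (Fin I)) (f : Fin I → ℝ≥0∞ → ℝ) :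
    ∑ i, f i (bound Γ₀ J i) = ∑ i ∈ J, f i (ENNReal.ofReal Γ₀) + ∑ i ∈ Jᶜ, f i ⊤ := by
  rw [← Finset.sum_add_sum_compl J]
  refine congrArg₂ _ (Finset.sum_congr rfl fun i hi => ?_) (Finset.sum_congr rfl fun i hi => ?_)
  · simp [bound, hi]
  · simp [bound, Finset.mem_compl.1 hi]

lemma muVec_bound (Γ₀ : ℝ) (J : Finset (Fin I)) :
    S.muVec (bound Γ₀ J) =
      ∑ i ∈ J, S.muSet i (ENNReal.ofReal Γ₀) + ∑ i ∈ Jᶜ, ⨆ j, S.q0 i j := by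
  simp only [muVec_eq_sum, sum_bound Γ₀ J fun i Γ => S.muSet i Γ, muSet_top]

/-- In this form, maximizing over `J` of fixed size means minimizing the sum of the gaps. -/
lemma muVec_bound_eq_sub (Γ₀ : ℝ) (J : Finset (Fin I)) :
    S.muVec (bound Γ₀ J) = ∑ i, S.muSet i ⊤ - ∑ i ∈ J, S.gap Γ₀ i := by
  rw [muVec_eq_sum, sum_bound Γ₀ J fun i Γ => S.muSet i Γ, ← Finset.sum_add_sum_compl J]
  simp only [gap, Finset.sum_sub_distrib]
  ring

lemma varVec_bound (Γ₀ : ℝ) (J : Finset (Fin I)) :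
    S.varVec (bound Γ₀ J) = ∑ i ∈ J, S.v2 Γ₀ i := by
  rw [varVec_eq_sum, sum_bound Γ₀ J fun i Γ => S.varSet i Γ]
  simp [varSet_top, v2]

variable {S}

lemma IsRankSet.gap_le {Γ₀ : ℝ} {k : ℕ} {J : Finset (Fin I)} (hJ : S.IsRankSet Γ₀ k J)
    {i j : Fin I} (hi : i ∈ J) (hj : j ∉ J) : S.gap Γ₀ i ≤ S.gap Γ₀ j :=
  (hJ.2 i hi j hj).elim le_of_lt fun h => h.1.le

lemma IsRankSet.sub_nonneg_of_mem_product {Γ₀ : ℝ} {k : ℕ} {J K : Finset (Fin I)}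
    (hJ : S.IsRankSet Γ₀ k J) {x : Fin I × Fin I} (hx : x ∈ (J \ K) ×ˢ (K \ J)) :
    0 ≤ S.gap Γ₀ x.2 - S.gap Γ₀ x.1 := by
  simp only [Finset.mem_product, Finset.mem_sdiff] at hx
  exact sub_nonneg.2 (hJ.gap_le hx.1.1 hx.2.2)

lemma IsRankSet.muVec_le {Γ₀ : ℝ} {k : ℕ} {J K : Finset (Fin I)} (hJ : S.IsRankSet Γ₀ k J)
    (hK : K.card = k) : S.muVec (bound Γ₀ K) ≤ S.muVec (bound Γ₀ J) := by
  rcases eq_or_ne J K with rfl | hne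
  · exact le_rfl
  have hcard : J.card = K.card := hJ.1.trans hK.symm
  have h : 0 ≤ ∑ i ∈ K, S.gap Γ₀ i - ∑ i ∈ J, S.gap Γ₀ i := by
    refine nonneg_of_mul_nonneg_right ?_ (card_sdiff_pos hcard hne)
    rw [card_sdiff_mul_sum_sub_sum hcard]
    exact Finset.sum_nonneg fun x hx => hJ.sub_nonneg_of_mem_product hx
  rw [muVec_bound_eq_sub, muVec_bound_eq_sub]
  linarith

/-- Equal maximal means force every exchanged pair to have equal gaps, and on ties the ranking
prefers the larger variance. -/
lemma IsRankSet.varVec_le {Γ₀ : ℝ} {k : ℕ} {J K : Finset (Fin I)} (hJ : S.IsRankSet Γ₀ k J)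
    (hK : K.card = k) (hmu : S.muVec (bound Γ₀ K) = S.muVec (bound Γ₀ J)) :
    S.varVec (bound Γ₀ K) ≤ S.varVec (bound Γ₀ J) := by
  rcases eq_or_ne J K with rfl | hne
  · exact le_rfl
  have hcard : J.card = K.card := hJ.1.trans hK.symm
  rw [muVec_bound_eq_sub, muVec_bound_eq_sub] at hmu
  have hgap := card_sdiff_mul_sum_sub_sum hcard (S.gap Γ₀)
  rw [show ∑ i ∈ K, S.gap Γ₀ i - ∑ i ∈ J, S.gap Γ₀ i = 0 by linarith, mul_zero, eq_comm,
    Finset.sum_eq_zero_iff_of_nonneg fun x hx => hJ.sub_nonneg_of_mem_product hx] at hgap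
  have h : ((J \ K).card : ℝ) * (∑ i ∈ K, S.v2 Γ₀ i - ∑ i ∈ J, S.v2 Γ₀ i) ≤ 0 := by
    rw [card_sdiff_mul_sum_sub_sum hcard]
    refine Finset.sum_nonpos fun x hx => ?_
    have h0 := hgap x hx
    simp only [Finset.mem_product, Finset.mem_sdiff] at hx
    rcases hJ.2 x.1 hx.1.1 x.2 hx.2.2 with hlt | ⟨-, hle⟩
    · linarith
    · linarith
  have := nonpos_of_mul_nonpos_right h (card_sdiff_pos hcard hne)
  rw [varVec_bound, varVec_bound]
  linarith

lemma IsRankSet.muVec_eq {Γ₀ : ℝ} {k : ℕ} {J : Finset (Fin I)} (hJ : S.IsRankSet Γ₀ k J) :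
    S.muVec (bound Γ₀ J) = S.muK Γ₀ k := by
  symm
  refine IsGreatest.csSup_eq ⟨⟨J, hJ.1, rfl⟩, ?_⟩
  rintro _ ⟨K, hK, rfl⟩
  exact hJ.muVec_le hK

lemma IsRankSet.varVec_eq {Γ₀ : ℝ} {k : ℕ} {J : Finset (Fin I)} (hJ : S.IsRankSet Γ₀ k J) :
    S.varVec (bound Γ₀ J) = S.varK Γ₀ k := by
  symm
  refine IsGreatest.csSup_eq ⟨⟨J, ⟨hJ.1, hJ.muVec_eq⟩, rfl⟩, ?_⟩
  rintro _ ⟨K, ⟨hK, hmu⟩, rfl⟩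
  exact hJ.varVec_le hK (hmu.trans hJ.muVec_eq.symm)

variable (S)

/-! ### The true assignment mechanism -/

/-- The true law of the treated unit of set `i`. -/
def law (i : Fin I) (j : Fin (S.n i)) : ℝ := (S.pStar i j).toReal

lemma measurable_Z_apply (i : Fin I) : Measurable fun ω => S.Z ω i :=
  (measurable_pi_apply i).comp S.measurable_Z

lemma integral_comp_Z (i : Fin I) (f : Fin (S.n i) → ℝ) :
    ∫ ω, f (S.Z ω i) ∂S.P = ∑ j, S.law i j * f j := by
  have := S.isProb
  have : IsProbabilityMeasure (S.P.map fun ω => S.Z ω i) :=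
    Measure.isProbabilityMeasure_map (S.measurable_Z_apply i).aemeasurable
  rw [← integral_map (S.measurable_Z_apply i).aemeasurable (by fun_prop),
    integral_fintype .of_finite]
  refine Finset.sum_congr rfl fun j _ => ?_
  rw [smul_eq_mul, Measure.real, Measure.map_apply (S.measurable_Z_apply i)
    (measurableSet_singleton j)]
  rfl

lemma law_mem_stdSimplex (i : Fin I) : S.law i ∈ stdSimplex ℝ (Fin (S.n i)) := by
  have := S.isProb
  refine ⟨fun j => ENNReal.toReal_nonneg, ?_⟩
  simpa using (S.integral_comp_Z i fun _ => 1).symm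

variable {S}

lemma obs_eq_of_fisherNull (h : S.FisherNull) (z : S.Assign) : S.obs z = S.Y0 := by
  funext i j
  simp only [obs, ← h i j]
  ring

lemma Ti_eq_of_fisherNull (h : S.FisherNull) (i : Fin I) (ω : Ω) :
    S.Ti i ω = S.q0 i (S.Z ω i) := by
  rw [Ti, obs_eq_of_fisherNull h, tset_eq, q0]

lemma mean_eq_of_fisherNull (h : S.FisherNull) (i : Fin I) : S.mean i = S.setMean i (S.law i) := by
  simp only [mean, Ti_eq_of_fisherNull h, integral_comp_Z S i (S.q0 i), setMean]

lemma measurable_Ti_of_fisherNull (h : S.FisherNull) (i : Fin I) : Measurable (S.Ti i) := by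
  rw [funext (Ti_eq_of_fisherNull h i)]
  exact (measurable_of_finite (S.q0 i)).comp (S.measurable_Z_apply i)

lemma var_eq_of_fisherNull (h : S.FisherNull) (i : Fin I) : S.var i = S.setVar i (S.law i) := by
  rw [var, variance_eq_integral (measurable_Ti_of_fisherNull h i).aemeasurable]
  change ∫ ω, (S.Ti i ω - S.mean i) ^ 2 ∂S.P = _
  simp only [mean_eq_of_fisherNull h, Ti_eq_of_fisherNull h]
  exact S.integral_comp_Z i fun j => (S.q0 i j - S.setMean i (S.law i)) ^ 2

variable (S)

lemma law_le_mul {Γ : ℝ} (hΓ : 0 ≤ Γ) {i : Fin I} (h : S.GammaStar i ≤ ENNReal.ofReal Γ)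
    (j l : Fin (S.n i)) : S.law i j ≤ Γ * S.law i l := by
  have := S.isProb
  have hfin (j : Fin (S.n i)) : S.pStar i j ≠ ⊤ := measure_ne_top _ _
  have hinf : (⨅ j, S.pStar i j) ≠ ⊤ := ne_top_of_le_ne_top (hfin l) (iInf_le _ l)
  rw [GammaStar] at h
  have hsup : (⨆ j, S.pStar i j) ≤ ENNReal.ofReal Γ * ⨅ j, S.pStar i j := by
    -- With a zero minimum, a nonzero maximum would make the ratio infinite; a zero maximum makes
    -- the claim trivial.
    rcases eq_or_ne (⨅ j, S.pStar i j) 0 with h0 | h0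
    · rcases eq_or_ne (⨆ j, S.pStar i j) 0 with h1 | h1
      · rw [h1]; exact zero_le
      · rw [h0, ENNReal.div_zero h1, top_le_iff] at h
        exact absurd h ENNReal.ofReal_ne_top
    · exact (ENNReal.div_le_iff h0 hinf).1 h
  have hjl : S.pStar i j ≤ ENNReal.ofReal Γ * S.pStar i l :=
    (le_iSup _ j).trans (hsup.trans (mul_le_mul_right (iInf_le _ l) _))
  have := ENNReal.toReal_mono (ENNReal.mul_ne_top ENNReal.ofReal_ne_top (hfin l)) hjl
  rwa [ENNReal.toReal_mul, ENNReal.toReal_ofReal hΓ] at this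

lemma law_mem_sensLaws {Γ : ℝ} (hΓ : 1 ≤ Γ) {i : Fin I}
    (h : S.GammaStar i ≤ ENNReal.ofReal Γ) :
    S.law i ∈ sensLaws (S.n i) (ENNReal.ofReal Γ) :=
  mem_sensLaws_of_le_mul hΓ (S.law_mem_stdSimplex i) (S.law_le_mul (by linarith) h)

lemma one_le_GammaStar (i : Fin I) (h : S.GammaStar i ≠ ⊤) : 1 ≤ (S.GammaStar i).toReal := by
  have hle := S.law_le_mul (Γ := (S.GammaStar i).toReal) ENNReal.toReal_nonneg
    (i := i) (ENNReal.ofReal_toReal h).ge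
  by_contra! hlt
  have hzero (j : Fin (S.n i)) : S.law i j ≤ 0 := by
    have := hle j j
    have := (S.law_mem_stdSimplex i).1 j
    nlinarith
  have := (S.law_mem_stdSimplex i).2
  linarith [Finset.sum_nonpos fun j (_ : j ∈ Finset.univ) => hzero j]

/-- The true law obeys the bound `Γᵢ⋆` in its own set, so `div_le_setVar` applies there; a set of
infinite bias contributes zero. -/
lemma info_le_sum_var (h : S.FisherNull) : S.info ≤ ∑ i, S.var i := by
  refine Finset.sum_le_sum fun i _ => ?_
  rw [var_eq_of_fisherNull h]
  by_cases htop : S.GammaStar i = ⊤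
  · have hn : (S.n i : ℝ≥0∞) ≠ 0 := by exact_mod_cast (NeZero.ne (S.n i))
    rw [htop, ENNReal.mul_top hn, ENNReal.top_pow (by norm_num), ENNReal.div_top]
    exact S.setVar_nonneg i (S.law_mem_stdSimplex i)
  · have hΓ := S.one_le_GammaStar i htop
    have := S.div_le_setVar i hΓ (S.law_mem_sensLaws hΓ (ENNReal.ofReal_toReal htop).ge)
    simpa [ENNReal.toReal_div, ENNReal.toReal_pow, ENNReal.toReal_mul,
      ENNReal.toReal_ofReal (sq_nonneg (S.R i))] using this

lemma infoOn_le_sum_v2 {Γ₀ : ℝ} (hΓ : 1 ≤ Γ₀) (J : Finset (Fin I)) :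
    S.infoOn Γ₀ J ≤ ∑ i ∈ J, S.v2 Γ₀ i := by
  refine Finset.sum_le_sum fun i _ => ?_
  obtain ⟨p, hp, -, h⟩ := S.exists_setMean_eq_setVar_eq i (ENNReal.ofReal Γ₀)
  rw [v2, ← h]
  exact S.div_le_setVar i hΓ hp

end MatchedStudy

/-! ### Order statistics and a square-root inequality -/

lemma IsKSmallest.le_orderStat {I k : ℕ} {f : Fin I → ℝ≥0∞} {J : Finset (Fin I)}
    (h : IsKSmallest f k J) (hk : 1 ≤ k) (hkI : k ≤ I) {i : Fin I} (hi : i ∈ J) :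
    f i ≤ orderStat f k := by
  have hk1 : k - 1 < I := by omega
  rw [orderStat, dif_pos hk1]
  by_contra! hlt
  -- The indices at sorted positions `0, …, k - 1`. If `f i` exceeded the order statistic, they
  -- would all lie in `J` and hence exhaust it, leaving no room for `i`.
  let A : Finset (Fin I) := (Finset.Iic (⟨k - 1, hk1⟩ : Fin I)).map (Tuple.sort f).toEmbedding
  have hA : A.card = k := by
    rw [Finset.card_map, Fin.card_Iic]
    simp only
    omega
  have hAlt (a : Fin I) (ha : a ∈ A) : f a < f i := by
    obtain ⟨l, hl, rfl⟩ := Finset.mem_map.1 ha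
    exact (Tuple.monotone_sort f (Finset.mem_Iic.1 hl)).trans_lt hlt
  have hsub : A ⊆ J := fun a ha => by
    by_contra haJ
    exact (h.2 i hi a haJ).not_gt (hAlt a ha)
  have heq : A = J := Finset.eq_of_subset_of_card_le hsub (by rw [hA, h.1])
  exact lt_irrefl _ (hAlt i (heq ▸ hi))

/-- Only `V`, not `W`, is bounded below: this suffices as `√V (√V - √W) ≤ V - W` when `W ≤ V`. -/
lemma sqrt_le_sqrt_add_div_sqrt {s V W d : ℝ} (hs : 0 < s) (hsV : s ≤ V) (hW : 0 ≤ W)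
    (hd : 0 ≤ d) (h : V - W ≤ d) : √V ≤ √W + d / √s := by
  rcases le_total V W with hVW | hVW
  · have := Real.sqrt_le_sqrt hVW
    have : 0 ≤ d / √s := by positivity
    linarith
  · have hV : 0 < √V := Real.sqrt_pos.2 (hs.trans_le hsV)
    have h1 : √V - √W ≤ d / √V := by
      rw [le_div_iff₀ hV]
      have hle := mul_le_mul_of_nonneg_left (Real.sqrt_le_sqrt hVW) (Real.sqrt_nonneg W)
      nlinarith [Real.mul_self_sqrt hW, Real.mul_self_sqrt (hs.trans_le hsV).le]
    have h2 : d / √V ≤ d / √s :=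
      div_le_div_of_nonneg_left hd (Real.sqrt_pos.2 hs) (Real.sqrt_le_sqrt hsV)
    linarith

namespace MatchedStudy

variable {I : ℕ} {Ω : Type*} [MeasurableSpace Ω] (S : MatchedStudy I Ω)

/-! ### Comparison of the true Gaussian quantile with the worst-case one -/

lemma law_mem_sensLaws_bound {Γ₀ : ℝ} (hΓ : 1 ≤ Γ₀) {K : Finset (Fin I)}
    (hK : ∀ i ∈ K, S.GammaStar i ≤ ENNReal.ofReal Γ₀) (i : Fin I) :
    S.law i ∈ sensLaws (S.n i) (bound Γ₀ K i) := by
  by_cases hi : i ∈ K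
  · simpa [bound, hi] using S.law_mem_sensLaws hΓ (hK i hi)
  · simpa [bound, hi, sensLaws_top] using S.law_mem_stdSimplex i

lemma varVec_nonneg (Γ : Fin I → ℝ≥0∞) : 0 ≤ S.varVec Γ := by
  rw [varVec_eq_sum]
  exact Finset.sum_nonneg fun i _ => S.varSet_nonneg i _

lemma sum_mean_add_mul_sqrt_le (hnull : S.FisherNull) {Γ : Fin I → ℝ≥0∞}
    (hlaw : ∀ i, S.law i ∈ sensLaws (S.n i) (Γ i)) {c : ℝ} (hc : 0 ≤ c) (hinfo : 0 < S.info)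
    (hratio : ENNReal.ofReal c < S.ratioA Γ) :
    ∑ i, S.mean i + c * √(∑ i, S.var i) ≤ S.muVec Γ + c * √(S.varVec Γ) := by
  have hmean (i : Fin I) : 0 ≤ S.muSet i (Γ i) - S.mean i := by
    rw [mean_eq_of_fisherNull hnull]
    exact sub_nonneg.2 (S.setMean_le_muSet i (hlaw i))
  have hmu : ∑ i ∈ S.setA Γ, (S.muSet i (Γ i) - S.mean i) ≤ S.muVec Γ - ∑ i, S.mean i := by
    rw [muVec_eq_sum, ← Finset.sum_sub_distrib]
    exact Finset.sum_le_sum_of_subset_of_nonneg (Finset.subset_univ _) fun i _ _ => hmean i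
  -- Sets outside `setA` only help, so they are dropped; likewise for the means above.
  have hvar : ∑ i, S.var i - S.varVec Γ ≤ ∑ i ∈ S.setA Γ, (S.var i - S.varSet i (Γ i)) := by
    rw [varVec_eq_sum, ← Finset.sum_sub_distrib,
      ← Finset.sum_filter_add_sum_filter_not Finset.univ fun i => S.varSet i (Γ i) < S.var i]
    refine add_le_of_nonpos_right (Finset.sum_nonpos fun i hi => ?_)
    linarith [not_lt.1 (Finset.mem_filter.1 hi).2]
  rcases (S.setA Γ).eq_empty_or_nonempty with hA | hA
  · rw [hA, Finset.sum_empty] at hmu hvar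
    have : √(∑ i, S.var i) ≤ √(S.varVec Γ) := Real.sqrt_le_sqrt (by linarith)
    have := mul_le_mul_of_nonneg_left this hc
    linarith
  · set M := ∑ i ∈ S.setA Γ, (S.muSet i (Γ i) - S.mean i)
    set D := ∑ i ∈ S.setA Γ, (S.var i - S.varSet i (Γ i))
    have hD : 0 < D := Finset.sum_pos (fun i hi => sub_pos.2 (Finset.mem_filter.1 hi).2) hA
    have hcard : ((S.setA Γ).card : ℝ)⁻¹ ≠ 0 := by simpa using hA.ne_empty
    have hs : 0 < √S.info := Real.sqrt_pos.2 hinfo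
    -- The cardinalities in the two averages cancel, leaving `c * D < M * √info`.
    rw [ratioA, if_neg hA.ne_empty, ENNReal.ofReal_lt_ofReal_iff_of_nonneg hc, deltaMu, deltaVar,
      mul_div_mul_left _ _ hcard, div_mul_eq_mul_div, lt_div_iff₀ hD] at hratio
    have hsqrt := sqrt_le_sqrt_add_div_sqrt hinfo (S.info_le_sum_var hnull) (S.varVec_nonneg Γ)
      hD.le hvar
    have hcD : c * (D / √S.info) ≤ M := by
      rw [← mul_div_assoc, div_le_iff₀ hs]
      exact hratio.le
    have := mul_le_mul_of_nonneg_left hsqrt hc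
    rw [mul_add] at this
    linarith

variable {S}

lemma IsRankSet.muVec_add_mul_sqrt_le {Γ₀ : ℝ} (hΓ : 1 ≤ Γ₀) {k : ℕ} {J K : Finset (Fin I)}
    (hJ : S.IsRankSet Γ₀ k J) (hK : K.card = k) {c : ℝ} (hc : 0 ≤ c)
    (hratio : ENNReal.ofReal c < S.ratioB Γ₀ J K) :
    S.muVec (bound Γ₀ K) + c * √(S.varVec (bound Γ₀ K)) ≤
      S.muVec (bound Γ₀ J) + c * √(S.varVec (bound Γ₀ J)) := by
  rcases eq_or_ne J K with rfl | hne
  · exact le_rfl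
  have hcard : J.card = K.card := hJ.1.trans hK.symm
  have hr := card_sdiff_pos hcard hne
  set r : ℝ := ((J \ K).card : ℝ)
  have hgap := card_sdiff_mul_sum_sub_sum hcard (S.gap Γ₀)
  have hv2 := card_sdiff_mul_sum_sub_sum hcard (S.v2 Γ₀)
  have hmu : ∑ x ∈ S.setB Γ₀ J K, (S.gap Γ₀ x.2 - S.gap Γ₀ x.1) ≤
      r * (S.muVec (bound Γ₀ J) - S.muVec (bound Γ₀ K)) := by
    rw [muVec_bound_eq_sub, muVec_bound_eq_sub, sub_sub_sub_cancel_left, hgap]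
    exact Finset.sum_le_sum_of_subset_of_nonneg (Finset.filter_subset _ _)
      fun x hx _ => hJ.sub_nonneg_of_mem_product hx
  have hvar : r * (S.varVec (bound Γ₀ K) - S.varVec (bound Γ₀ J)) ≤
      ∑ x ∈ S.setB Γ₀ J K, (S.v2 Γ₀ x.2 - S.v2 Γ₀ x.1) := by
    rw [varVec_bound, varVec_bound, hv2,
      ← Finset.sum_filter_add_sum_filter_not _ fun x => S.v2 Γ₀ x.1 < S.v2 Γ₀ x.2]
    refine add_le_of_nonpos_right (Finset.sum_nonpos fun x hx => ?_)
    linarith [not_lt.1 (Finset.mem_filter.1 hx).2]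
  rcases (S.setB Γ₀ J K).eq_empty_or_nonempty with hB | hB
  · rw [hB, Finset.sum_empty] at hvar
    have h1 := nonpos_of_mul_nonpos_right hvar hr
    have : √(S.varVec (bound Γ₀ K)) ≤ √(S.varVec (bound Γ₀ J)) :=
      Real.sqrt_le_sqrt (by linarith)
    have := mul_le_mul_of_nonneg_left this hc
    linarith [hJ.muVec_le hK]
  · set M := ∑ x ∈ S.setB Γ₀ J K, (S.gap Γ₀ x.2 - S.gap Γ₀ x.1)
    set D := ∑ x ∈ S.setB Γ₀ J K, (S.v2 Γ₀ x.2 - S.v2 Γ₀ x.1)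
    have hD : 0 < D := Finset.sum_pos (fun x hx => sub_pos.2 (Finset.mem_filter.1 hx).2) hB
    have hcardB : ((S.setB Γ₀ J K).card : ℝ)⁻¹ ≠ 0 := by simpa using hB.ne_empty
    rw [ratioB, if_neg hB.ne_empty, ENNReal.ofReal_lt_ofReal_iff_of_nonneg hc, deltaMuB,
      deltaVarB, mul_div_mul_left _ _ hcardB, div_mul_eq_mul_div, lt_div_iff₀ hD] at hratio
    -- Positivity is not assumed here: a zero root would turn the ratio condition into `c * D < 0`.
    have hs : 0 < √(S.infoOn Γ₀ K) := by
      refine (Real.sqrt_nonneg _).lt_of_ne fun h0 => ?_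
      rw [← h0, mul_zero] at hratio
      exact hratio.not_ge (by positivity)
    have hle : S.infoOn Γ₀ K ≤ S.varVec (bound Γ₀ K) := by
      rw [varVec_bound]
      exact S.infoOn_le_sum_v2 hΓ K
    have hsqrt := sqrt_le_sqrt_add_div_sqrt (Real.sqrt_pos.1 hs) hle
      (S.varVec_nonneg (bound Γ₀ J)) (div_pos hD hr).le ((le_div_iff₀' hr).2 hvar)
    have hcD : c * (D / r / √(S.infoOn Γ₀ K)) ≤ M / r := by
      rw [div_right_comm, ← mul_div_assoc, ← mul_div_assoc]
      gcongr
      rw [div_le_iff₀ hs]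
      exact hratio.le
    have hM := (div_le_iff₀' hr).2 hmu
    have := mul_le_mul_of_nonneg_left hsqrt hc
    rw [mul_add] at this
    linarith

/-! ### Asymptotic normality of the test statistic -/

variable (S)

lemma sq_R_le_iSup (i : Fin I) : S.R i ^ 2 ≤ ⨆ i, S.R i ^ 2 :=
  le_ciSup (f := fun i => S.R i ^ 2) (Set.finite_range _).bddAbove i

/-- The centred statistic of set `i`, in units of the true standard deviation of the whole
statistic. -/
noncomputable def standardized (i : Fin I) (ω : Ω) : ℝ := (S.Ti i ω - S.mean i) / √(∑ i, S.var i)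

variable {S}

lemma measurable_standardized (h : S.FisherNull) (i : Fin I) : Measurable (S.standardized i) :=
  ((measurable_Ti_of_fisherNull h i).sub_const _).div_const _

lemma iIndepFun_standardized (h : S.FisherNull) : iIndepFun S.standardized S.P := by
  have hcomp := S.indep.comp
    (fun i j => (S.q0 i j - S.mean i) / √(∑ i, S.var i)) fun i => measurable_of_finite _
  convert hcomp using 2 with i
  funext ω
  simp [standardized, Ti_eq_of_fisherNull h]

lemma abs_standardized_le (h : S.FisherNull) (i : Fin I) (ω : Ω) :
    |S.standardized i ω| ≤ √(⨆ i, S.R i ^ 2) / √(∑ i, S.var i) := by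
  rw [standardized, abs_div, abs_of_nonneg (Real.sqrt_nonneg (∑ i, S.var i)),
    Ti_eq_of_fisherNull h, mean_eq_of_fisherNull h]
  gcongr
  exact (S.abs_q0_sub_setMean_le i (S.law_mem_stdSimplex i) _).trans
    (Real.le_sqrt_of_sq_le (S.sq_R_le_iSup i))

lemma integral_standardized (h : S.FisherNull) (i : Fin I) :
    ∫ ω, S.standardized i ω ∂S.P = 0 := by
  simp only [standardized, Ti_eq_of_fisherNull h]
  rw [S.integral_comp_Z i fun j => (S.q0 i j - S.mean i) / √(∑ i, S.var i),
    mean_eq_of_fisherNull h]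
  simp only [← mul_div_assoc, ← Finset.sum_div, mul_sub, Finset.sum_sub_distrib,
    ← Finset.sum_mul, (S.law_mem_stdSimplex i).2, one_mul]
  rw [← setMean, sub_self, zero_div]

lemma sum_integral_sq_standardized (h : S.FisherNull) (hvar : 0 < ∑ i, S.var i) :
    ∑ i, ∫ ω, S.standardized i ω ^ 2 ∂S.P = 1 := by
  have hi (i : Fin I) : ∫ ω, S.standardized i ω ^ 2 ∂S.P = S.var i / ∑ i, S.var i := by
    simp only [standardized, div_pow, Real.sq_sqrt hvar.le, integral_div]
    rw [var, variance_eq_integral (measurable_Ti_of_fisherNull h i).aemeasurable]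
    rfl
  simp only [hi, ← Finset.sum_div]
  exact div_self hvar.ne'

lemma sum_standardized (ω : Ω) :
    ∑ i, S.standardized i ω = (S.T ω - ∑ i, S.mean i) / √(∑ i, S.var i) := by
  simp only [standardized, ← Finset.sum_div, Finset.sum_sub_distrib, T, t, Ti]

end MatchedStudy

/-- Asymptotic normality of the test statistic of a sequence of matched studies. -/
theorem tendsto_measureReal_le_T {Ω : ℕ → Type*} [∀ I, MeasurableSpace (Ω I)]
    (S : (I : ℕ) → MatchedStudy I (Ω I)) (hnull : ∀ I, (S I).FisherNull)
    (hpos : ∀ᶠ I in atTop, 0 < (S I).info)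
    (hclt : Tendsto (fun I => (⨆ i, (S I).R i ^ 2) / (S I).info) atTop (𝓝 0)) (c : ℝ) :
    Tendsto (fun I => (S I).P.real
        {ω | ∑ i, (S I).mean i + c * √(∑ i, (S I).var i) ≤ (S I).T ω}) atTop
      (𝓝 (1 - cdf (gaussianReal 0 1) c)) := by
  have (I : ℕ) : IsProbabilityMeasure (S I).P := (S I).isProb
  have hvar : ∀ᶠ I in atTop, 0 < ∑ i, (S I).var i :=
    hpos.mono fun I h => h.trans_le ((S I).info_le_sum_var (hnull I))
  have hb : Tendsto (fun I => √(⨆ i, (S I).R i ^ 2) / √(∑ i, (S I).var i)) atTop (𝓝 0) := by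
    have hsqrt : Tendsto (fun I => √((⨆ i, (S I).R i ^ 2) / (S I).info)) atTop (𝓝 0) := by
      simpa using hclt.sqrt
    refine squeeze_zero' (Eventually.of_forall fun I => by positivity) ?_ hsqrt
    filter_upwards [hpos] with I hI
    rw [Real.sqrt_div' _ hI.le]
    exact div_le_div_of_nonneg_left (Real.sqrt_nonneg _) (Real.sqrt_pos.2 hI)
      (Real.sqrt_le_sqrt ((S I).info_le_sum_var (hnull I)))
  have h := tendsto_measureReal_sum_ge_of_bounded (P := fun I => (S I).P)
    (X := fun I => (S I).standardized)
    (fun I => MatchedStudy.measurable_standardized (hnull I))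
    (fun I => MatchedStudy.iIndepFun_standardized (hnull I))
    (fun I => MatchedStudy.abs_standardized_le (hnull I))
    (fun I => MatchedStudy.integral_standardized (hnull I))
    (hvar.mono fun I => MatchedStudy.sum_integral_sq_standardized (hnull I)) hb c
  refine h.congr' (hvar.mono fun I hI => ?_)
  refine congrArg _ (Set.ext fun ω => ?_)
  simp only [Set.mem_ofPred_eq, MatchedStudy.sum_standardized]
  rw [le_div_iff₀ (Real.sqrt_pos.2 hI), le_sub_iff_add_le']

/-! ### The theorem -/

theorem theorem5
    {Ω : ℕ → Type*} [∀ I, MeasurableSpace (Ω I)]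
    (S : (I : ℕ) → MatchedStudy I (Ω I))
    (k : ℕ → ℕ) (Γ₀ : ℕ → ℝ)
    (hk : ∀ I, 1 ≤ I → 1 ≤ k I ∧ k I ≤ I)
    (hΓ₀ : ∀ I, 1 ≤ I → 1 ≤ Γ₀ I)
    -- Fisher's null hypothesis
    (hnull : ∀ I, (S I).FisherNull)
    -- the true hidden bias at rank `k` is at most `Γ₀`
    (hbias : ∀ I, 1 ≤ I → orderStat (S I).GammaStar (k I) ≤ ENNReal.ofReal (Γ₀ I))
    -- `K I`: the `k` sets with the smallest true hidden biases
    (K : (I : ℕ) → Finset (Fin I))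
    (hK : ∀ I, 1 ≤ I → IsKSmallest (S I).GammaStar (k I) (K I))
    -- `J I`: the `k` sets of smallest rank
    (J : (I : ℕ) → Finset (Fin I))
    (hJ : ∀ I, 1 ≤ I → (S I).IsRankSet (Γ₀ I) (k I) (J I))
    -- first regularity condition (the denominator is eventually nonzero)
    (hpos : ∀ᶠ I in atTop, 0 < (S I).info)
    (hclt : Tendsto (fun I => (⨆ i, (S I).R i ^ 2) / (S I).info) atTop (𝓝 0))
    -- second regularity condition
    (hA : Tendsto (fun I => (S I).ratioA (MatchedStudy.bound (Γ₀ I) (K I))) atTop (𝓝 ⊤))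
    -- third regularity condition
    (hB : Tendsto (fun I => (S I).ratioB (Γ₀ I) (J I) (K I)) atTop (𝓝 ⊤)) :
    -- the set `J I` attains both maxima, with explicit values
    (∀ I, 1 ≤ I →
      (S I).muVec (MatchedStudy.bound (Γ₀ I) (J I)) = (S I).muK (Γ₀ I) (k I) ∧
      (S I).varVec (MatchedStudy.bound (Γ₀ I) (J I)) = (S I).varK (Γ₀ I) (k I) ∧
      (S I).muK (Γ₀ I) (k I) =
        ∑ i ∈ J I, (S I).muSet i (ENNReal.ofReal (Γ₀ I)) + ∑ i ∈ (J I)ᶜ, ⨆ j, (S I).q0 i j ∧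
      (S I).varK (Γ₀ I) (k I) = ∑ i ∈ J I, (S I).varSet i (ENNReal.ofReal (Γ₀ I))) ∧
    ∀ c : ℝ, 0 ≤ c →
      -- the Gaussian tail bound
      limsup (fun I => (S I).P.real
          {ω | (S I).muK (Γ₀ I) (k I) + c * (S I).sdK (Γ₀ I) (k I) ≤ (S I).T ω}) atTop
        ≤ 1 - cdf (gaussianReal 0 1) c ∧
      -- the bound is the tail probability of the normal law with the maximized mean and variance
      ∀ I, 1 ≤ I → 0 < (S I).varK (Γ₀ I) (k I) →
        (gaussianReal ((S I).muK (Γ₀ I) (k I)) ((S I).varK (Γ₀ I) (k I)).toNNReal).real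
            (Set.Ici ((S I).muK (Γ₀ I) (k I) + c * (S I).sdK (Γ₀ I) (k I)))
          = 1 - cdf (gaussianReal 0 1) c := by
  have hvalues (I : ℕ) (hI : 1 ≤ I) :
      (S I).muVec (MatchedStudy.bound (Γ₀ I) (J I)) = (S I).muK (Γ₀ I) (k I) ∧
      (S I).varVec (MatchedStudy.bound (Γ₀ I) (J I)) = (S I).varK (Γ₀ I) (k I) :=
    ⟨(hJ I hI).muVec_eq, (hJ I hI).varVec_eq⟩
  refine ⟨fun I hI => ⟨(hvalues I hI).1, (hvalues I hI).2, ?_, ?_⟩, fun c hc => ⟨?_, ?_⟩⟩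
  · rw [← (hvalues I hI).1, MatchedStudy.muVec_bound]
  · rw [← (hvalues I hI).2, MatchedStudy.varVec_bound]
    rfl
  · have hprob (I : ℕ) : IsProbabilityMeasure (S I).P := (S I).isProb
    have hlim := tendsto_measureReal_le_T S hnull hpos hclt c
    -- The bound is the limit of the tail probabilities at the true threshold, so it is enough that
    -- the event at the worst-case threshold is eventually contained in the one at the true
    -- threshold.
    rw [← hlim.limsup_eq]
    refine limsup_le_limsup ?_ ?_ hlim.isBoundedUnder_le
    · filter_upwards [eventually_ge_atTop 1, hpos,
        hA.eventually_const_lt ENNReal.ofReal_lt_top,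
        hB.eventually_const_lt ENNReal.ofReal_lt_top] with I hI hinfo hratioA hratioB
      have hbiasK (i : Fin I) (hi : i ∈ K I) :
          (S I).GammaStar i ≤ ENNReal.ofReal (Γ₀ I) :=
        ((hK I hI).le_orderStat (hk I hI).1 (hk I hI).2 hi).trans (hbias I hI)
      have h1 := (S I).sum_mean_add_mul_sqrt_le (hnull I)
        ((S I).law_mem_sensLaws_bound (hΓ₀ I hI) hbiasK) hc hinfo hratioA
      have h2 := (hJ I hI).muVec_add_mul_sqrt_le (hΓ₀ I hI) (hK I hI).1 hc hratioB
      rw [(hvalues I hI).1, (hvalues I hI).2] at h2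
      exact measureReal_mono fun ω hω => (h1.trans h2).trans hω
    · exact isCoboundedUnder_le_of_le atTop (x := 0) fun I => measureReal_nonneg
  · intro I _ hvar
    exact gaussianReal_real_Ici_add_mul_sqrt _ c hvar
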